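/- Let $1\le r\le\infty$, let $\mathcal O$ be a compact and $\mathcal P$ an arbitrary (effective, paracompact Hausdorff) $C^{r+1}$ orbifold without boundary, of dimensions $n$ and $m$, with charts $(\tilde U_x,\Gamma_x)$ at $x\in\mathcal O$ and $(\tilde V_z,\Gamma_z)$ at $z\in\mathcal P$ and chart embeddings $\tilde\psi_{zx}$, equivariant with respect to injective homomorphisms $\theta_{zx}:\Gamma_z\to\Gamma_x$. Let ${}_\star f=(f,\{\tilde f_x\},\{\Theta_{f,x}\})$ be a $C^{r+1}$ complete orbifold map $\mathcal O\to\mathcal P$: a continuous map $f$ together with homomorphisms $\Theta_{f,x}:\Gamma_x\to\Gamma_{f(x)}$ and $\Theta_{f,x}$-equivariant $C^{r+1}$ lifts $\tilde f_x:\tilde U_x\to\tilde V_{f(x)}$ of $f$ (after shrinking $\tilde U_x$). Its pullback orbibundle ${}_\star f^*(T\mathcal P)\to\mathcal O$ has the charts $\tilde U_x\times_{\tilde V_{f(x)}}T\tilde V_{f(x)}\cong\tilde U_x\times\mathbb R^m$ with the actions $\gamma\cdot(\tilde y,\tilde v)=(\gamma\cdot\tilde y,\,d(\Theta_{f,x}(\gamma))_{\tilde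 f_x(\tilde y)}\tilde v)$ of $\Gamma_x$, glued by $(\tilde y,\tilde v)\mapsto(\tilde\psi_{zx}(\tilde y),\,d(\eta_{zx})_{\tilde f_z(\tilde y)}\tilde v)$; here $\eta_{zx}=\varepsilon_{zx}\cdot\tilde\psi_{f(z)f(x)}$ with $\varepsilon_{zx}\in\Gamma_{f(x)}$ are given chart changes of $\mathcal P$ along $f$, that is, near the respective base points $\tilde f_x\circ\tilde\psi_{zx}=\eta_{zx}\circ\tilde f_z$, $\ \Theta_{f,x}(\theta_{zx}(\gamma))\,\varepsilon_{zx}=\varepsilon_{zx}\,\theta_{f(z)f(x)}(\Theta_{f,z}(\gamma))$, and $\eta_{zx}\circ\eta_{wz}=\Theta_{f,x}(\delta)\cdot\eta_{wx}$ where $\delta\in\Gamma_x$ is such that $\tilde\psi_{zx}\circ\tilde\psi_{wz}=\delta\cdot\tilde\psi_{wx}$. Let $\mathscr D^r_{\mathrm{Orb}}({}_\star f^*(T\mathcal P))$ be the set of $C^r$ orbisections of this bundle: the $C^r$ orbifold maps $\sigma:\mathcal O\to{}_\star f^*(T\mathcal P)$ over the identity whose lifts have the form $\tilde\sigma_x(\tilde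 y)=(\tilde y,\tilde s_x(\tilde y))$. Give it the topology induced by the inclusion into the set $C^r_{\mathrm{Orb}}(\mathcal O,{}_\star f^*(T\mathcal P))$ of $C^r$ orbifold maps with the $C^r$ topology (uniform closeness of the derivatives of order at most $r$ of the lifts over compact subsets of charts; all finite orders if $r=\infty$). Then, with the operations $\tilde s_x\mapsto\tilde s_x+\tilde t_x$ and $\tilde s_x\mapsto a\tilde s_x$ on lifts, $\mathscr D^r_{\mathrm{Orb}}({}_\star f^*(T\mathcal P))$ is a topological vector space, and it is a separable Banach space if $r<\infty$ and a separable Fréchet space if $r=\infty$. Moreover there are finitely many invariant compact subsets $\tilde C_1,\dots,\tilde C_N$ of charts of $\mathcal O$, each the closure of its interior, whose images cover $\mathcal O$, such that $\sigma\mapsto(\tilde s_i|_{\tilde C_i})_{i}$ is a linear homeomorphism of $\mathscr D^r_{\mathrm{Orb}}({}_\star f^*(T\mathcal P))$ onto a closed subspace of $\bigoplus_{i=1}^N C^r(\tilde C_i,\mathbb R^m)$, where $C^r(\tilde C_i,\mathbb R^m)$ carries the topology of uniform convergence of all derivatives of order $\le r$. -/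

import Mathlib

open Set Filter Topology

/-- The model space `ℝⁿ`. -/
abbrev Eu (n : ℕ) : Type := EuclideanSpace ℝ (Fin n)

/-- A `C^k` orbifold chart `(Ũ_x, Γ_x, ρ_x, φ_x)` at `x`: a connected open set `Ũ_x = dom ⊆ ℝⁿ`, a
finite group `Γ_x` acting effectively on it by `C^k` maps and fixing the point `x̃ = center`, and a
map `proj : Ũ_x → X` over `x` which induces a homeomorphism `φ_x` of `Ũ_x / Γ_x` onto an open
subset `U_x` of `X` (it is continuous and open, and its fibres are the orbits). Values of `act`
and `proj` outside `dom` carry no meaning. -/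
structure OrbifoldChart (n : ℕ) (k : ℕ∞) (X : Type*) [TopologicalSpace X] (x : X) where
  dom : Set (Eu n)
  isOpen_dom : IsOpen dom
  isConnected_dom : IsConnected dom
  Γ : Type
  [group : Group Γ]
  [finite : Finite Γ]
  act : Γ → Eu n → Eu n
  mapsTo_act : ∀ γ, MapsTo (act γ) dom dom
  act_one : ∀ y ∈ dom, act 1 y = y
  act_mul : ∀ γ δ, ∀ y ∈ dom, act (γ * δ) y = act γ (act δ y)
  contDiffOn_act : ∀ γ, ContDiffOn ℝ (k : WithTop ℕ∞) (act γ) dom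
  effective : ∀ γ, (∀ y ∈ dom, act γ y = y) → γ = 1
  proj : Eu n → X
  continuousOn_proj : ContinuousOn proj dom
  isOpen_image_proj : ∀ V ⊆ dom, IsOpen V → IsOpen (proj '' V)
  proj_eq_iff : ∀ y ∈ dom, ∀ y' ∈ dom, proj y = proj y' ↔ ∃ γ, act γ y = y'
  center : Eu n
  center_mem : center ∈ dom
  act_center : ∀ γ, act γ center = center
  proj_center : proj center = x

attribute [instance] OrbifoldChart.group OrbifoldChart.finite

/-- A smaller orbifold chart at `x` with the same group: a connected open invariant neighbourhood
`W` of `x̃` in `Ũ_x` on which `Γ_x` acts effectively. -/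
structure OrbifoldChart.IsSubchart {n : ℕ} {k : ℕ∞} {X : Type*} [TopologicalSpace X] {x : X}
    (c : OrbifoldChart n k X x) (W : Set (Eu n)) : Prop where
  isOpen : IsOpen W
  isConnected : IsConnected W
  subset_dom : W ⊆ c.dom
  center_mem : c.center ∈ W
  mapsTo_act : ∀ γ, MapsTo (c.act γ) W W
  effective : ∀ γ, (∀ y ∈ W, c.act γ y = y) → γ = 1

/-- A `C^k` orbifold structure of dimension `n` on `X`: an orbifold chart at each point `x`, and for
`z ∈ U_x` an open `C^k` embedding `ψ̃_zx = ψ z x` of an invariant neighbourhood of `z̃` in `Ũ_z`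
(a smaller chart at `z`) into `Ũ_x`, which covers the inclusion and is equivariant with respect to
an injective homomorphism `θ_zx = θ z x : Γ_z → Γ_x`. For `z ∉ U_x` the values `ψ z x` and `θ z x`
carry no meaning. -/
structure Orbifold (n : ℕ) (k : ℕ∞) (X : Type*) [TopologicalSpace X] where
  chart : ∀ x : X, OrbifoldChart n k X x
  ψ : X → X → OpenPartialHomeomorph (Eu n) (Eu n)
  θ : ∀ z x : X, (chart z).Γ →* (chart x).Γ
  center_mem_source : ∀ z x, z ∈ (chart x).proj '' (chart x).dom →
    (chart z).center ∈ (ψ z x).source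
  source_subset : ∀ z x, z ∈ (chart x).proj '' (chart x).dom → (ψ z x).source ⊆ (chart z).dom
  target_subset : ∀ z x, z ∈ (chart x).proj '' (chart x).dom → (ψ z x).target ⊆ (chart x).dom
  contDiffOn_ψ : ∀ z x, z ∈ (chart x).proj '' (chart x).dom →
    ContDiffOn ℝ (k : WithTop ℕ∞) (ψ z x) (ψ z x).source
  contDiffOn_ψ_symm : ∀ z x, z ∈ (chart x).proj '' (chart x).dom →
    ContDiffOn ℝ (k : WithTop ℕ∞) (ψ z x).symm (ψ z x).target
  proj_ψ : ∀ z x, z ∈ (chart x).proj '' (chart x).dom →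
    ∀ y ∈ (ψ z x).source, (chart x).proj (ψ z x y) = (chart z).proj y
  mapsTo_act_source : ∀ z x, z ∈ (chart x).proj '' (chart x).dom →
    ∀ γ, MapsTo ((chart z).act γ) (ψ z x).source (ψ z x).source
  ψ_act : ∀ z x, z ∈ (chart x).proj '' (chart x).dom → ∀ γ, ∀ y ∈ (ψ z x).source,
    ψ z x ((chart z).act γ y) = (chart x).act (θ z x γ) (ψ z x y)
  injective_θ : ∀ z x, z ∈ (chart x).proj '' (chart x).dom → Function.Injective (θ z x)

section CompleteMaps

variable {n m : ℕ} {k : ℕ∞} {X Y : Type*} [TopologicalSpace X] [TopologicalSpace Y]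

/-- A (representative of a) `C^k` complete orbifold map `(f, {f̃_x}, {Θ_{f,x}})`: a continuous map
`f`, homomorphisms `Θ_{f,x} : Γ_x → Γ_{f(x)}`, and on a chart `W_x = dom x ⊆ Ũ_x` at each `x` a
`Θ_{f,x}`-equivariant `C^k` lift `f̃_x : W_x → Ṽ_{f(x)}` of `f`. -/
structure CompleteOrbifoldMap (O : Orbifold n k X) (P : Orbifold m k Y) where
  toFun : X → Y
  continuous_toFun : Continuous toFun
  Θ : ∀ x, (O.chart x).Γ →* (P.chart (toFun x)).Γ
  dom : X → Set (Eu n)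
  isSubchart_dom : ∀ x, (O.chart x).IsSubchart (dom x)
  lift : X → Eu n → Eu m
  mapsTo_lift : ∀ x, MapsTo (lift x) (dom x) (P.chart (toFun x)).dom
  contDiffOn_lift : ∀ x, ContDiffOn ℝ (k : WithTop ℕ∞) (lift x) (dom x)
  lift_act : ∀ x γ, ∀ y ∈ dom x,
    lift x ((O.chart x).act γ y) = (P.chart (toFun x)).act (Θ x γ) (lift x y)
  proj_lift : ∀ x, ∀ y ∈ dom x,
    (P.chart (toFun x)).proj (lift x y) = toFun ((O.chart x).proj y)

namespace CompleteOrbifoldMap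

variable {O : Orbifold n k X} {P : Orbifold m k Y}

/-- The open subset of `X` covered by the chart `W_x` on which `f̃_x` is defined. -/
def base (f : CompleteOrbifoldMap O P) (x : X) : Set X := (O.chart x).proj '' f.dom x

/-- The chart change `η_zx = ε · ψ̃_{f(z)f(x)}` from `Ṽ_{f(z)}` to `Ṽ_{f(x)}`, where `ε ∈ Γ_{f(x)}`. -/
def changeOf (f : CompleteOrbifoldMap O P) (z x : X) (ε : (P.chart (f.toFun x)).Γ) :
    Eu m → Eu m :=
  fun u => (P.chart (f.toFun x)).act ε (P.ψ (f.toFun z) (f.toFun x) u)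

/-- The transition data along which the charts `W_x ×_{Ṽ_{f(x)}} TṼ_{f(x)}` of the pullback of the
tangent orbibundle are glued to an orbibundle. As chart changes are only determined up to the
local groups, it is a choice, for `z ∈ U_x`, of a chart change `η_zx = ε_zx · ψ̃_{f(z)f(x)}` with
`f̃_x ∘ ψ̃_zx = η_zx ∘ f̃_z`, compatible with the homomorphisms `Θ`, and coherent: whenever
`ψ̃_zx ∘ ψ̃_wz = δ · ψ̃_wx`, also `η_zx ∘ η_wz = Θ_{f,x}(δ) · η_wx`. -/
structure Transitions (f : CompleteOrbifoldMap O P) where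
  ε : ∀ _z x : X, (P.chart (f.toFun x)).Γ
  lift_ψ : ∀ z x, z ∈ f.base x → ∀ᶠ y in 𝓝 (O.chart z).center,
    f.lift x (O.ψ z x y) = f.changeOf z x (ε z x) (f.lift z y)
  Θ_θ : ∀ z x, z ∈ f.base x → ∀ γ,
    f.Θ x (O.θ z x γ) * ε z x = ε z x * P.θ (f.toFun z) (f.toFun x) (f.Θ z γ)
  cocycle : ∀ z x, z ∈ f.base x → ∀ᶠ y in 𝓝 (O.chart z).center, ∀ w, w = (O.chart z).proj y →
    ∃ δ : (O.chart x).Γ,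
      (∀ᶠ u in 𝓝 (O.chart w).center,
        O.ψ z x (O.ψ w z u) = (O.chart x).act δ (O.ψ w x u)) ∧
      (∀ᶠ u in 𝓝 (P.chart (f.toFun w)).center,
        f.changeOf z x (ε z x) (f.changeOf w z (ε w z) u) =
          (P.chart (f.toFun x)).act (f.Θ x δ) (f.changeOf w x (ε w x) u))

namespace Transitions

variable {f : CompleteOrbifoldMap O P} (T : f.Transitions)

/-- The chart change `η_zx` of the target. -/
def η (z x : X) : Eu m → Eu m := f.changeOf z x (T.ε z x)

/-- The action of `Γ_x` on the chart `W_x ×_{Ṽ_{f(x)}} TṼ_{f(x)}` of the pullback, in the coordinates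
`(ỹ, v) ↔ (ỹ, [f̃_x(ỹ), v])` that identify this chart with `W_x × ℝᵐ`:
`γ · (ỹ, v) = (γ · ỹ, d(Θ_{f,x}(γ))_{f̃_x(ỹ)} v)`. -/
noncomputable def bundleAct (_T : f.Transitions) (x : X) (γ : (O.chart x).Γ) (q : Eu n × Eu m) :
    Eu n × Eu m :=
  ((O.chart x).act γ q.1,
    fderiv ℝ ((P.chart (f.toFun x)).act (f.Θ x γ)) (f.lift x q.1) q.2)

/-- The chart change `(ỹ, v) ↦ (ψ̃_zx(ỹ), d(η_zx)_{f̃_z(ỹ)} v)` of the pullback. -/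
noncomputable def bundleψ (z x : X) (q : Eu n × Eu m) : Eu n × Eu m :=
  (O.ψ z x q.1, fderiv ℝ (T.η z x) (f.lift z q.1) q.2)

/-- The disjoint union of the charts `W_x × ℝᵐ` of the pullback. -/
abbrev Pre (_T : f.Transitions) : Type _ := Σ x : X, (f.dom x) × Eu m

/-- The identifications in the disjoint union of the charts: by the groups `Γ_x`, and of the fibre
over `w̃` in the chart at `w` with a fibre in the chart at `x` by the chart change, for `w ∈ U_x`.
Every point over `w` in the chart at `x` is in the `Γ_x`-orbit of `ψ̃_wx(w̃)`. -/
inductive Rel : T.Pre → T.Pre → Prop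
  | act (x : X) (γ : (O.chart x).Γ) (y y' : f.dom x) (v v' : Eu m)
      (h : ((y' : Eu n), v') = T.bundleAct x γ ((y : Eu n), v)) : Rel ⟨x, (y, v)⟩ ⟨x, (y', v')⟩
  | change (w x : X) (hw : w ∈ f.base x) (y : f.dom w) (y' : f.dom x) (v v' : Eu m)
      (hy : (y : Eu n) = (O.chart w).center)
      (h : ((y' : Eu n), v') = T.bundleψ w x ((y : Eu n), v)) : Rel ⟨w, (y, v)⟩ ⟨x, (y', v')⟩

/-- The underlying space of the pullback orbibundle `f^*(TP)`, with the quotient topology. -/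
def Total : Type _ := Quot T.Rel

instance : TopologicalSpace T.Total := inferInstanceAs (TopologicalSpace (Quot T.Rel))

/-- The quotient map `Π_x : W_x × ℝᵐ → f^*(TP)`. -/
def toTotal (x : X) (q : Eu n × Eu m) (h : q.1 ∈ f.dom x) : T.Total :=
  Quot.mk T.Rel ⟨x, (⟨q.1, h⟩, q.2)⟩

/-- The orbibundle projection `p : f^*(TP) → O`. -/
def bundleProj : T.Total → X :=
  Quot.lift (fun q : T.Pre => (O.chart q.1).proj (q.2.1 : Eu n)) <| by
    intro a b hab
    cases hab with
    | act x γ y y' v v' h =>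
      have h1 : (y' : Eu n) = (O.chart x).act γ y := congrArg Prod.fst h
      exact ((O.chart x).proj_eq_iff _ ((f.isSubchart_dom x).subset_dom y.2) _
        ((f.isSubchart_dom x).subset_dom y'.2)).2 ⟨γ, h1.symm⟩
    | change w x hw y y' v v' hy h =>
      have h1 : (y' : Eu n) = O.ψ w x y := congrArg Prod.fst h
      have hw' : w ∈ (O.chart x).proj '' (O.chart x).dom :=
        image_mono (f.isSubchart_dom x).subset_dom hw
      have hs : (y : Eu n) ∈ (O.ψ w x).source := hy ▸ O.center_mem_source w x hw'
      change (O.chart w).proj (y : Eu n) = (O.chart x).proj (y' : Eu n)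
      rw [h1, O.proj_ψ w x hw' _ hs]

/-- The points of the chart at `z` near which `bundleψ z x` is a chart change of the pullback, that
is, covers the identity of its underlying space. -/
def changeDom (z x : X) : Set (Eu n) :=
  {y | y ∈ (O.ψ z x).source ∧ f.lift z y ∈ (P.ψ (f.toFun z) (f.toFun x)).source ∧
    z ∈ f.base x ∧
    ∀ᶠ u in 𝓝 y, ∃ (h : u ∈ f.dom z) (h' : O.ψ z x u ∈ f.dom x), ∀ v : Eu m,
      T.toTotal z (u, v) h = T.toTotal x (T.bundleψ z x (u, v)) h'}

/-- A representative of a `C^r` orbifold map `(g, {g̃_x})` from `O` to the pullback orbibundle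
`f^*(TP)`: a continuous map `g` and, on some chart at each `x`, a `C^r` lift `g̃_x` to the chart of
`f^*(TP)` over the point `p(g(x))`, equivariant with respect to some homomorphism. -/
structure MapRep (r : ℕ∞) where
  toFun : X → T.Total
  continuous_toFun : Continuous toFun
  dom : X → Set (Eu n)
  isSubchart_dom : ∀ x, (O.chart x).IsSubchart (dom x)
  lift : X → Eu n → Eu n × Eu m
  mapsTo_lift : ∀ x, ∀ y ∈ dom x, (lift x y).1 ∈ f.dom (T.bundleProj (toFun x))
  contDiffOn_lift : ∀ x, ContDiffOn ℝ (r : WithTop ℕ∞) (lift x) (dom x)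
  toTotal_lift : ∀ x, ∀ y, ∀ hy : y ∈ dom x,
    T.toTotal _ (lift x y) (mapsTo_lift x y hy) = toFun ((O.chart x).proj y)
  equivariant : ∀ x, ∃ Θ' : (O.chart x).Γ →* (O.chart (T.bundleProj (toFun x))).Γ,
    ∀ γ, ∀ y ∈ dom x, lift x ((O.chart x).act γ y) = T.bundleAct _ (Θ' γ) (lift x y)

/-- Two orbifold maps are equal if they have the same lifts at each `x`, as germs at `x̃`. -/
def mapSetoid (r : ℕ∞) : Setoid (T.MapRep r) where
  r g g' := g.toFun = g'.toFun ∧ ∀ x, g.lift x =ᶠ[𝓝 (O.chart x).center] g'.lift x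
  iseqv :=
    { refl := fun _ => ⟨rfl, fun _ => EventuallyEq.rfl⟩
      symm := fun h => ⟨h.1.symm, fun x => (h.2 x).symm⟩
      trans := fun h h' => ⟨h.1.trans h'.1, fun x => (h.2 x).trans (h'.2 x)⟩ }

/-- The set `C^r_Orb(O, f^*(TP))` of `C^r` orbifold maps. -/
def OrbMap (r : ℕ∞) : Type _ := Quotient (T.mapSetoid r)

/-- The subbasic `C^r` neighbourhood of the orbifold map `g₀`: the orbifold maps `g` such that, over
the compact subset `K` of a chart at `x`, the lifts of `g₀` and `g` at `x` can be transferred to the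
chart of `f^*(TP)` over `z`, and there differ by less than `ε` in all derivatives of order at most
`s`. -/
def mapNhd {r : ℕ∞} (g₀ : T.MapRep r) (x z : X) (K : Set (Eu n)) (s : ℕ) (ε : ℝ) :
    Set (T.OrbMap r) :=
  {q | ∃ g : T.MapRep r, Quotient.mk (T.mapSetoid r) g = q ∧ K ⊆ g.dom x ∧
    (∀ y ∈ K, (g.lift x y).1 ∈ T.changeDom (T.bundleProj (g.toFun x)) z) ∧
    ∀ j ≤ s, ∀ y ∈ K,
      ‖iteratedFDeriv ℝ j (fun u => T.bundleψ (T.bundleProj (g.toFun x)) z (g.lift x u)) y -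
        iteratedFDeriv ℝ j (fun u => T.bundleψ (T.bundleProj (g₀.toFun x)) z (g₀.lift x u)) y‖
        < ε}

/-- The `C^r` topology on `C^r_Orb(O, f^*(TP))`, generated by the neighbourhoods above with finite
orders `s ≤ r`. -/
instance (r : ℕ∞) : TopologicalSpace (T.OrbMap r) :=
  TopologicalSpace.generateFrom
    {N | ∃ (g₀ : T.MapRep r) (x z : X) (K : Set (Eu n)) (s : ℕ) (ε : ℝ),
      IsCompact K ∧ K ⊆ g₀.dom x ∧
      (∀ y ∈ K, (g₀.lift x y).1 ∈ T.changeDom (T.bundleProj (g₀.toFun x)) z) ∧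
      (s : ℕ∞) ≤ r ∧ 0 < ε ∧ N = T.mapNhd g₀ x z K s ε}

/-- A `C^r` orbisection `σ` of the pullback orbibundle `f^*(TP)`: a continuous map `σ` with
`p ∘ σ = Id` which has over each chart `W_x` an equivariant `C^r` lift `σ̃_x` with
`pr₁ ∘ σ̃_x = Id`, that is, `σ̃_x(ỹ) = (ỹ, s̃_x(ỹ))`. The function `s̃_x = repr x` matters only on
`W_x`, so it is put to be `0` elsewhere, in order that equal orbisections be equal. -/
@[ext]
structure Orbisection (r : ℕ∞) where
  toFun : X → T.Total
  continuous_toFun : Continuous toFun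
  bundleProj_toFun : ∀ x, T.bundleProj (toFun x) = x
  repr : X → Eu n → Eu m
  repr_eq_zero : ∀ x, ∀ y, y ∉ f.dom x → repr x y = 0
  contDiffOn_repr : ∀ x, ContDiffOn ℝ (r : WithTop ℕ∞) (repr x) (f.dom x)
  toTotal_repr : ∀ x, ∀ y, ∀ hy : y ∈ f.dom x,
    T.toTotal x (y, repr x y) hy = toFun ((O.chart x).proj y)
  equivariant : ∀ x, ∃ Θ' : (O.chart x).Γ →* (O.chart x).Γ, ∀ γ, ∀ y ∈ f.dom x,
    ((O.chart x).act γ y, repr x ((O.chart x).act γ y)) = T.bundleAct x (Θ' γ) (y, repr x y)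

/-- An orbisection as an orbifold map, with the lifts `σ̃_x(ỹ) = (ỹ, s̃_x(ỹ))`. -/
def Orbisection.toMapRep {r : ℕ∞} (σ : T.Orbisection r) : T.MapRep r where
  toFun := σ.toFun
  continuous_toFun := σ.continuous_toFun
  dom := f.dom
  isSubchart_dom := f.isSubchart_dom
  lift x y := (y, σ.repr x y)
  mapsTo_lift x y hy := by rw [σ.bundleProj_toFun x]; exact hy
  contDiffOn_lift x := contDiffOn_id.prodMk (σ.contDiffOn_repr x)
  toTotal_lift x y hy := by
    have key : ∀ z, z = x → ∀ h : y ∈ f.dom z,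
        T.toTotal z (y, σ.repr x y) h = σ.toFun ((O.chart x).proj y) := by
      rintro z rfl h
      exact σ.toTotal_repr z y h
    exact key _ (σ.bundleProj_toFun x) _
  equivariant x := by
    have key : ∀ z, z = x → ∃ Θ' : (O.chart x).Γ →* (O.chart z).Γ, ∀ γ, ∀ y ∈ f.dom x,
        ((O.chart x).act γ y, σ.repr x ((O.chart x).act γ y)) =
          T.bundleAct z (Θ' γ) (y, σ.repr x y) := by
      rintro z rfl
      exact σ.equivariant z
    exact key _ (σ.bundleProj_toFun x)

/-- The inclusion of the set of `C^r` orbisections into `C^r_Orb(O, f^*(TP))`. -/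
def Orbisection.toOrbMap {r : ℕ∞} (σ : T.Orbisection r) : T.OrbMap r :=
  Quotient.mk (T.mapSetoid r) (Orbisection.toMapRep T σ)

/-- The `C^r` topology on the set of orbisections, induced by the inclusion. -/
instance (r : ℕ∞) : TopologicalSpace (T.Orbisection r) :=
  TopologicalSpace.induced (Orbisection.toOrbMap T) inferInstance

end Transitions

end CompleteOrbifoldMap

end CompleteMaps

/-- The topological vector space `C^r(K, F)`, for `K ⊆ ℝⁿ` a compact set which is the closure of its
interior: the `C^r` functions `g` on the interior of `K` whose derivatives of order `j ≤ r` extend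
continuously to `K`, with the topology of uniform convergence of all derivatives of order `≤ r`. An
element is given as the family of the extended derivatives. -/
def CrSpace {n : ℕ} (r : ℕ∞) (K : Set (Eu n)) (F : Type*) [NormedAddCommGroup F]
    [NormedSpace ℝ F] :
    Submodule ℝ (∀ j : {j : ℕ // (j : ℕ∞) ≤ r}, C(K, Eu n [×(j : ℕ)]→L[ℝ] F)) where
  carrier := {J | ∃ g : Eu n → F, ContDiffOn ℝ (r : WithTop ℕ∞) g (interior K) ∧
    ∀ j, ∀ y : K, (y : Eu n) ∈ interior K → J j y = iteratedFDeriv ℝ (j : ℕ) g y}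
  zero_mem' := by
    refine ⟨0, contDiffOn_const, fun j y _ => ?_⟩
    simp
  add_mem' := by
    rintro J J' ⟨g, hg, hJ⟩ ⟨g', hg', hJ'⟩
    refine ⟨g + g', hg.add hg', fun j y hy => ?_⟩
    have hj : ((j : ℕ) : WithTop ℕ∞) ≤ (r : WithTop ℕ∞) := by exact_mod_cast j.2
    have h1 := (hg.contDiffAt (isOpen_interior.mem_nhds hy)).of_le hj
    have h2 := (hg'.contDiffAt (isOpen_interior.mem_nhds hy)).of_le hj
    rw [iteratedFDeriv_add_apply h1 h2, ← hJ j y hy, ← hJ' j y hy]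
    rfl
  smul_mem' := by
    rintro c J ⟨g, hg, hJ⟩
    refine ⟨c • g, hg.const_smul c, fun j y hy => ?_⟩
    have hj : ((j : ℕ) : WithTop ℕ∞) ≤ (r : WithTop ℕ∞) := by exact_mod_cast j.2
    have h1 := (hg.contDiffAt (isOpen_interior.mem_nhds hy)).of_le hj
    rw [iteratedFDeriv_const_smul_apply h1, ← hJ j y hy]
    rfl

/-- The topological vector space `V` is a Banach space: its topology is that of a complete norm. -/
def IsBanachable.{u} (V : Type u) [AddCommGroup V] [Module ℝ V] [TopologicalSpace V] : Prop :=
  ∃ (B : Type u) (_ : NormedAddCommGroup B) (_ : NormedSpace ℝ B) (_ : CompleteSpace B),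
    Nonempty (V ≃L[ℝ] B)

/-- The topological vector space `V` is a Fréchet space: it is locally convex, metrizable and
complete. -/
def IsFrechet (V : Type*) [AddCommGroup V] [Module ℝ V] [TopologicalSpace V]
    [IsTopologicalAddGroup V] : Prop :=
  LocallyConvexSpace ℝ V ∧ TopologicalSpace.MetrizableSpace V ∧
    @CompleteSpace V (IsTopologicalAddGroup.rightUniformSpace V)

/-!
An orbisection is the same thing as a family of local representatives, one on each chart, which are
equivariant and related at the centres of the charts by the differentials `d(η_zx)`: effectiveness
of the local groups forces the homomorphisms belonging to the lifts to be the identity. Such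
families form a vector space. The cocycle condition moves the relation away from the centres, so
that near any two points of charts with the same image in `O` the representatives differ by a `C^r`
change of coordinates and a `C^r` family of linear isomorphisms (a *transfer*). Hence the `C^r`
distance of two orbisections on any compact subset of a chart is bounded by their distance on
finitely many compact sets `K_i` whose images cover `O`, and the jets on the `K_i` embed the
orbisections into a finite product of spaces of continuous functions. The image is closed: uniform
limits of the jets on the `K_i` transfer to every chart, and there they are again compatible.
-/

/-! ### Actions of the local groups -/

section NearIdentity

variable {𝕜 E : Type*} [NontriviallyNormedField 𝕜] [NormedAddCommGroup E] [NormedSpace 𝕜 E]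

theorem eventually_eq_self_of_iterate_eq_self [CharZero 𝕜] [CompleteSpace E] {f : E → E} {y : E}
    {N : ℕ} (hN : N ≠ 0) (hf : HasStrictFDerivAt f (ContinuousLinearMap.id 𝕜 E) y) (hy : f y = y)
    (hfN : ∀ᶠ u in 𝓝 y, f^[N] u = u) : ∀ᶠ u in 𝓝 y, f u = u := by
  -- The sum of the iterates is `f`-invariant, and a local coordinate since its derivative is `N`.
  let h : E → E := fun u => ∑ i ∈ Finset.range N, f^[i] u
  let e : E ≃L[𝕜] E := ContinuousLinearEquiv.smulLeft (Units.mk0 (N : 𝕜) (Nat.cast_ne_zero.2 hN))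
  have hh : HasStrictFDerivAt h (e : E →L[𝕜] E) y := by
    have hsum := HasStrictFDerivAt.fun_sum fun i (_ : i ∈ Finset.range N) => hf.iterate hy i
    convert hsum using 1
    ext v
    have hone : ContinuousLinearMap.id 𝕜 E = 1 := rfl
    simp [e, Units.smul_def, hone, Nat.cast_smul_eq_nsmul]
  have hinv : ∀ u, f^[N] u = u → h (f u) = h u := fun u hu => by
    have hsucc := Finset.sum_range_succ (fun i => f^[i] u) N
    rw [Finset.sum_range_succ', hu] at hsucc
    exact add_right_cancel hsucc
  have hleft := hh.eventually_left_inverse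
  have hleft' : ∀ᶠ u in 𝓝 y, hh.localInverse h e y (h (f u)) = f u :=
    hf.continuousAt.eventually (by rwa [hy])
  filter_upwards [hleft, hleft', hfN] with u hu hfu hNu
  rw [← hfu, hinv u hNu, hu]

theorem eq_self_and_fderiv_eq_id_of_mem_closure {h : E → E} {z : E} (hc : ContinuousAt h z)
    (hd : ContinuousAt (fderiv 𝕜 h) z) (hz : z ∈ closure (interior {u | h u = u})) :
    h z = z ∧ fderiv 𝕜 h z = ContinuousLinearMap.id 𝕜 E := by
  have hfreq := mem_closure_iff_frequently.1 hz
  refine ⟨tendsto_nhds_unique_of_frequently_eq hc tendsto_id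
    (hfreq.mono fun u hu => (interior_subset hu : u ∈ {u | h u = u})),
    tendsto_nhds_unique_of_frequently_eq hd tendsto_const_nhds (hfreq.mono fun u hu => ?_)⟩
  have hloc : h =ᶠ[𝓝 u] id := mem_interior_iff_mem_nhds.1 hu
  rw [hloc.fderiv_eq, fderiv_id]

end NearIdentity

theorem coe_withTop_ne_zero_of_one_le {k : ℕ∞} (hk : 1 ≤ k) : (k : WithTop ℕ∞) ≠ 0 := by
  exact_mod_cast Order.one_le_iff_ne_zero.1 hk

namespace OrbifoldChart

variable {n : ℕ} {k : ℕ∞} {X : Type*} [TopologicalSpace X] {x : X} (c : OrbifoldChart n k X x)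

theorem act_inv_act (γ : c.Γ) {y : Eu n} (hy : y ∈ c.dom) : c.act γ⁻¹ (c.act γ y) = y := by
  rw [← c.act_mul _ _ _ hy, inv_mul_cancel, c.act_one _ hy]

theorem act_act_inv (γ : c.Γ) {y : Eu n} (hy : y ∈ c.dom) : c.act γ (c.act γ⁻¹ y) = y := by
  rw [← c.act_mul _ _ _ hy, mul_inv_cancel, c.act_one _ hy]

theorem act_pow (γ : c.Γ) (i : ℕ) {y : Eu n} (hy : y ∈ c.dom) :
    c.act (γ ^ i) y = (c.act γ)^[i] y := by
  induction i generalizing y with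
  | zero => rw [pow_zero, c.act_one y hy, Function.iterate_zero_apply]
  | succ i ih =>
    rw [pow_succ, c.act_mul _ _ _ hy, ih (c.mapsTo_act γ hy), Function.iterate_succ_apply]

theorem eq_of_act_eq_act {γ δ : c.Γ} {y : Eu n} (hy : y ∈ c.dom)
    (hfree : ∀ γ, c.act γ y = y → γ = 1) (h : c.act γ y = c.act δ y) : γ = δ :=
  (inv_mul_eq_one.1 (hfree _ (by rw [c.act_mul _ _ _ hy, h, c.act_inv_act _ hy]))).symm

theorem contDiffAt_act (γ : c.Γ) {y : Eu n} (hy : y ∈ c.dom) :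
    ContDiffAt ℝ (k : WithTop ℕ∞) (c.act γ) y :=
  (c.contDiffOn_act γ).contDiffAt (c.isOpen_dom.mem_nhds hy)

theorem continuousAt_act (γ : c.Γ) {y : Eu n} (hy : y ∈ c.dom) : ContinuousAt (c.act γ) y :=
  (c.contDiffAt_act γ hy).continuousAt

theorem hasStrictFDerivAt_act (hk : 1 ≤ k) (γ : c.Γ) {y : Eu n} (hy : y ∈ c.dom) :
    HasStrictFDerivAt (c.act γ) (fderiv ℝ (c.act γ) y) y :=
  (c.contDiffAt_act γ hy).hasStrictFDerivAt (coe_withTop_ne_zero_of_one_le hk)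

theorem differentiableAt_act (hk : 1 ≤ k) (γ : c.Γ) {y : Eu n} (hy : y ∈ c.dom) :
    DifferentiableAt ℝ (c.act γ) y :=
  (c.hasStrictFDerivAt_act hk γ hy).differentiableAt

theorem continuousAt_fderiv_act (hk : 1 ≤ k) (γ : c.Γ) {y : Eu n} (hy : y ∈ c.dom) :
    ContinuousAt (fderiv ℝ (c.act γ)) y :=
  ((c.contDiffOn_act γ).continuousOn_fderiv_of_isOpen c.isOpen_dom
    (by exact_mod_cast hk)).continuousAt (c.isOpen_dom.mem_nhds hy)

theorem fderiv_act_mul (hk : 1 ≤ k) (γ δ : c.Γ) {y : Eu n} (hy : y ∈ c.dom) :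
    fderiv ℝ (c.act (γ * δ)) y = (fderiv ℝ (c.act γ) (c.act δ y)).comp (fderiv ℝ (c.act δ) y) := by
  have h : c.act (γ * δ) =ᶠ[𝓝 y] c.act γ ∘ c.act δ := by
    filter_upwards [c.isOpen_dom.mem_nhds hy] with u hu using c.act_mul _ _ _ hu
  rw [h.fderiv_eq, fderiv_comp _ (c.differentiableAt_act hk γ (c.mapsTo_act δ hy))
    (c.differentiableAt_act hk δ hy)]

theorem fderiv_act_one {y : Eu n} (hy : y ∈ c.dom) :
    fderiv ℝ (c.act 1) y = ContinuousLinearMap.id ℝ (Eu n) := by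
  have h : c.act 1 =ᶠ[𝓝 y] id := by
    filter_upwards [c.isOpen_dom.mem_nhds hy] with u hu using c.act_one _ hu
  rw [h.fderiv_eq, fderiv_id]

theorem eventually_act_eq_self (hk : 1 ≤ k) (γ : c.Γ) {y : Eu n} (hy : y ∈ c.dom)
    (hfix : c.act γ y = y) (hd : fderiv ℝ (c.act γ) y = ContinuousLinearMap.id ℝ (Eu n)) :
    ∀ᶠ u in 𝓝 y, c.act γ u = u := by
  refine eventually_eq_self_of_iterate_eq_self (orderOf_pos γ).ne'
    (hd ▸ c.hasStrictFDerivAt_act hk γ hy) hfix ?_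
  filter_upwards [c.isOpen_dom.mem_nhds hy] with u hu
  rw [← c.act_pow γ _ hu, pow_orderOf_eq_one, c.act_one u hu]

theorem eq_one_of_eventually_act_eq_self (hk : 1 ≤ k) {γ : c.Γ} {y : Eu n} (hy : y ∈ c.dom)
    (h : ∀ᶠ u in 𝓝 y, c.act γ u = u) : γ = 1 := by
  have hsub : c.dom ⊆ interior {u | c.act γ u = u} := by
    refine c.isConnected_dom.isPreconnected.subset_of_closure_inter_subset isOpen_interior
      ⟨y, hy, mem_interior_iff_mem_nhds.2 h⟩ ?_
    rintro z ⟨hz, hzd⟩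
    obtain ⟨hfix, hd⟩ := eq_self_and_fderiv_eq_id_of_mem_closure (c.continuousAt_act γ hzd)
      (c.continuousAt_fderiv_act hk γ hzd) hz
    exact mem_interior_iff_mem_nhds.2 (c.eventually_act_eq_self hk γ hzd hfix hd)
  exact c.effective γ (hsub.trans interior_subset)

theorem isNowhereDense_fixedPoints (hk : 1 ≤ k) {γ : c.Γ} (hγ : γ ≠ 1) :
    IsNowhereDense {u | u ∈ c.dom ∧ c.act γ u = u} := by
  refine eq_empty_of_forall_notMem fun y hy => hγ ?_
  obtain ⟨z, hzy, hzd, -⟩ := mem_closure_iff_nhds.1 (interior_subset hy) _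
    (isOpen_interior.mem_nhds hy)
  refine c.eq_one_of_eventually_act_eq_self hk hzd ?_
  filter_upwards [isOpen_interior.mem_nhds hzy, c.isOpen_dom.mem_nhds hzd] with u hu hud
  exact tendsto_nhds_unique_of_frequently_eq (c.continuousAt_act γ hud) continuousAt_id
    ((mem_closure_iff_frequently.1 (interior_subset hu)).mono fun v hv => hv.2)

theorem frequently_free (hk : 1 ≤ k) {y : Eu n} (hy : y ∈ c.dom) :
    ∃ᶠ u in 𝓝 y, u ∈ c.dom ∧ ∀ γ, c.act γ u = u → γ = 1 := by
  have hmeagre : IsMeagre (⋃ γ ∈ {γ : c.Γ | γ ≠ 1}, {u | u ∈ c.dom ∧ c.act γ u = u}) :=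
    isMeagre_biUnion (toFinite _).countable
      fun γ hγ => (c.isNowhereDense_fixedPoints hk hγ).isMeagre
  have hfreq := (mem_closure_iff_frequently.1 (dense_of_mem_residual hmeagre y)).and_eventually
    (c.isOpen_dom.mem_nhds hy)
  refine hfreq.mono fun u hu => ⟨hu.2, fun γ hγ => ?_⟩
  by_contra hne
  exact hu.1 (mem_biUnion hne ⟨hu.2, hγ⟩)

section LiftsOfIdentity

variable {c} {D : Set (Eu n)} {h : Eu n → Eu n}

theorem exists_eventuallyEq_act_of_free (hDd : D ⊆ c.dom) (hmaps : MapsTo h D c.dom)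
    (hproj : ∀ y ∈ D, c.proj (h y) = c.proj y) {u : Eu n} (hD : D ∈ 𝓝 u) (hcont : ContinuousAt h u)
    (hfree : ∀ γ, c.act γ u = u → γ = 1) : ∃ γ, h =ᶠ[𝓝 u] c.act γ := by
  have hexists : ∀ v ∈ D, ∃ γ, c.act γ v = h v := fun v hv =>
    (c.proj_eq_iff v (hDd hv) (h v) (hmaps hv)).1 (hproj v hv).symm
  have hu := hDd (mem_of_mem_nhds hD)
  obtain ⟨γ, hγ⟩ := hexists u (mem_of_mem_nhds hD)
  have hother : ∀ᶠ v in 𝓝 u, ∀ δ : c.Γ, δ ≠ γ → h v ≠ c.act δ v := by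
    refine eventually_all.2 fun δ => eventually_imp_distrib_left.2 fun hδ => ?_
    exact (hcont.ne_iff_eventually_ne (c.continuousAt_act δ hu)).1
      fun he => hδ (c.eq_of_act_eq_act hu hfree (he.symm.trans hγ.symm))
  refine ⟨γ, ?_⟩
  filter_upwards [hother, hD] with v hv hvD
  obtain ⟨δ, hδ⟩ := hexists v hvD
  have hδγ : δ = γ := not_not.1 fun hne => hv δ hne hδ.symm
  rw [← hδ, hδγ]

theorem eventually_not_eventuallyEq_act (hk : 1 ≤ k) {z : Eu n} (hz : z ∈ c.dom)
    (hcont : ContinuousAt h z) (hderiv : ContinuousAt (fderiv ℝ h) z) (hfix : h z = z)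
    (hd : fderiv ℝ h z = ContinuousLinearMap.id ℝ (Eu n)) :
    ∀ᶠ u in 𝓝 z, ∀ γ : c.Γ, γ ≠ 1 → ¬ h =ᶠ[𝓝 u] c.act γ := by
  refine eventually_all.2 fun γ => eventually_imp_distrib_left.2 fun hγ => ?_
  by_cases hγz : c.act γ z = z
  · have hne : fderiv ℝ h z ≠ fderiv ℝ (c.act γ) z := fun he =>
      hγ (c.eq_one_of_eventually_act_eq_self hk hz (c.eventually_act_eq_self hk γ hz hγz (he ▸ hd)))
    filter_upwards [(hderiv.ne_iff_eventually_ne (c.continuousAt_fderiv_act hk γ hz)).1 hne]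
      with u hu he using hu he.fderiv_eq
  · have hne : h z ≠ c.act γ z := fun he => hγz (he ▸ hfix)
    filter_upwards [(hcont.ne_iff_eventually_ne (c.continuousAt_act γ hz)).1 hne]
      with u hu he using hu he.eq_of_nhds

/-- Differentiability excludes foldings: `y ↦ |y|` is a continuous lift of the identity of
`ℝ / {±1}`. -/
theorem eq_self_of_proj_eq (hk : 1 ≤ k) (hD : IsOpen D) (hDc : IsPreconnected D)
    (hDd : D ⊆ c.dom) (hh : ContDiffOn ℝ 1 h D) (hmaps : MapsTo h D c.dom)
    (hproj : ∀ y ∈ D, c.proj (h y) = c.proj y) {y₀ : Eu n} (hy₀ : y₀ ∈ D)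
    (hid : ∀ᶠ u in 𝓝 y₀, h u = u) : ∀ y ∈ D, h y = y := by
  suffices hsub : D ⊆ interior {u | h u = u} from hsub.trans interior_subset
  refine hDc.subset_of_closure_inter_subset isOpen_interior
    ⟨y₀, hy₀, mem_interior_iff_mem_nhds.2 hid⟩ ?_
  rintro z ⟨hz, hzD⟩
  have hcont : ∀ u ∈ D, ContinuousAt h u := fun u hu =>
    hh.continuousOn.continuousAt (hD.mem_nhds hu)
  have hderiv : ContinuousAt (fderiv ℝ h) z :=
    (hh.continuousOn_fderiv_of_isOpen hD le_rfl).continuousAt (hD.mem_nhds hzD)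
  obtain ⟨hfix, hd⟩ := eq_self_and_fderiv_eq_id_of_mem_closure (hcont z hzD) hderiv hz
  have hfree : ∀ᶠ u in 𝓝 z, (∀ γ, c.act γ u = u → γ = 1) → h u = u := by
    filter_upwards [eventually_not_eventuallyEq_act hk (hDd hzD) (hcont z hzD) hderiv hfix hd,
      hD.mem_nhds hzD] with u hne huD hu
    obtain ⟨γ, hγ⟩ := exists_eventuallyEq_act_of_free hDd hmaps hproj (hD.mem_nhds huD)
      (hcont u huD) hu
    have hγ1 : γ = 1 := not_not.1 fun h1 => hne γ h1 hγ
    rw [hγ.eq_of_nhds, hγ1, c.act_one u (hDd huD)]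
  rw [mem_interior_iff_mem_nhds]
  filter_upwards [hfree.eventually_nhds, hD.mem_nhds hzD] with u hu huD
  exact tendsto_nhds_unique_of_frequently_eq (hcont u huD) continuousAt_id
    (((c.frequently_free hk (hDd huD)).and_eventually hu).mono fun v hv => hv.2 hv.1.2)

end LiftsOfIdentity

end OrbifoldChart

namespace Orbifold

variable {n : ℕ} {k : ℕ∞} {X : Type*} [TopologicalSpace X] (O : Orbifold n k X) {z x : X}

/-- Test `δ` at a nearby point with trivial stabilizer. -/
theorem exists_θ_eq_of_act_ψ_center (hk : 1 ≤ k) (hz : z ∈ (O.chart x).proj '' (O.chart x).dom)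
    {δ : (O.chart x).Γ}
    (hδ : (O.chart x).act δ (O.ψ z x (O.chart z).center) = O.ψ z x (O.chart z).center) :
    ∃ γ, O.θ z x γ = δ := by
  have htarget := (O.ψ z x).map_source (O.center_mem_source z x hz)
  have hpd := O.target_subset z x hz htarget
  have hnhds := (O.ψ z x).open_target.mem_nhds htarget
  have hnhds' : ∀ᶠ u in 𝓝 (O.ψ z x (O.chart z).center),
      (O.chart x).act δ u ∈ (O.ψ z x).target :=
    (O.chart x).continuousAt_act δ hpd (by rwa [hδ])
  obtain ⟨u, ⟨hud, hfree⟩, hu, hδu⟩ :=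
    (((O.chart x).frequently_free hk hpd).and_eventually
      (Eventually.and hnhds hnhds')).exists
  have hs := (O.ψ z x).map_target hu
  have hδs := (O.ψ z x).map_target hδu
  have hproj : (O.chart z).proj ((O.ψ z x).symm u) =
      (O.chart z).proj ((O.ψ z x).symm ((O.chart x).act δ u)) := by
    rw [← O.proj_ψ z x hz _ hs, ← O.proj_ψ z x hz _ hδs, (O.ψ z x).right_inv hu,
      (O.ψ z x).right_inv hδu]
    exact ((O.chart x).proj_eq_iff _ hud _ ((O.chart x).mapsTo_act δ hud)).2 ⟨δ, rfl⟩
  obtain ⟨γ, hγ⟩ := ((O.chart z).proj_eq_iff _ (O.source_subset z x hz hs) _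
    (O.source_subset z x hz hδs)).1 hproj
  have hact := O.ψ_act z x hz γ _ hs
  rw [hγ, (O.ψ z x).right_inv hu, (O.ψ z x).right_inv hδu] at hact
  exact ⟨γ, (O.chart x).eq_of_act_eq_act hud hfree hact.symm⟩

theorem mem_proj_image_self (x : X) : x ∈ (O.chart x).proj '' (O.chart x).dom :=
  ⟨_, (O.chart x).center_mem, (O.chart x).proj_center⟩

theorem proj_ψ_center (hz : z ∈ (O.chart x).proj '' (O.chart x).dom) :
    (O.chart x).proj (O.ψ z x (O.chart z).center) = z := by
  rw [O.proj_ψ z x hz _ (O.center_mem_source z x hz), (O.chart z).proj_center]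

theorem ψ_self_center (x : X) : O.ψ x x (O.chart x).center = (O.chart x).center := by
  have hx := O.mem_proj_image_self x
  have hd := O.target_subset x x hx ((O.ψ x x).map_source (O.center_mem_source x x hx))
  obtain ⟨γ, hγ⟩ := ((O.chart x).proj_eq_iff _ (O.chart x).center_mem _ hd).1
    (by rw [O.proj_ψ_center hx, (O.chart x).proj_center])
  rw [← hγ, (O.chart x).act_center]

theorem contDiffAt_ψ (hz : z ∈ (O.chart x).proj '' (O.chart x).dom) {y : Eu n}
    (hy : y ∈ (O.ψ z x).source) : ContDiffAt ℝ (k : WithTop ℕ∞) (O.ψ z x) y :=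
  (O.contDiffOn_ψ z x hz).contDiffAt ((O.ψ z x).open_source.mem_nhds hy)

theorem contDiffAt_ψ_symm (hz : z ∈ (O.chart x).proj '' (O.chart x).dom) {y : Eu n}
    (hy : y ∈ (O.ψ z x).target) : ContDiffAt ℝ (k : WithTop ℕ∞) (O.ψ z x).symm y :=
  (O.contDiffOn_ψ_symm z x hz).contDiffAt ((O.ψ z x).open_target.mem_nhds hy)

end Orbifold

/-! ### Points of the pullback bundle -/

theorem eventuallyEq_of_comp_right {α β γ : Type*} {l : Filter α} {l' : Filter β} {g : α → β}
    {s : β → α} {a b : β → γ} (hs : Tendsto s l' l) (hgs : ∀ᶠ y in l', g (s y) = y)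
    (h : a ∘ g =ᶠ[l] b ∘ g) : a =ᶠ[l'] b := by
  filter_upwards [hs.eventually h, hgs] with y hy hys
  simpa only [Function.comp_apply, hys] using hy

namespace CompleteOrbifoldMap

variable {n m : ℕ} {k : ℕ∞} {X Y : Type*} [TopologicalSpace X] [TopologicalSpace Y]
  {O : Orbifold n k X} {P : Orbifold m k Y} (f : CompleteOrbifoldMap O P) {w z x : X}

theorem dom_subset (x : X) : f.dom x ⊆ (O.chart x).dom := (f.isSubchart_dom x).subset_dom

theorem center_mem_dom (x : X) : (O.chart x).center ∈ f.dom x := (f.isSubchart_dom x).center_mem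

theorem dom_mem_nhds {y : Eu n} (hy : y ∈ f.dom x) : f.dom x ∈ 𝓝 y :=
  (f.isSubchart_dom x).isOpen.mem_nhds hy

theorem act_mem_dom (γ : (O.chart x).Γ) {y : Eu n} (hy : y ∈ f.dom x) :
    (O.chart x).act γ y ∈ f.dom x := (f.isSubchart_dom x).mapsTo_act γ hy

theorem mem_base_self (x : X) : x ∈ f.base x :=
  ⟨_, f.center_mem_dom x, (O.chart x).proj_center⟩

theorem proj_mem_base {y : Eu n} (hy : y ∈ f.dom x) : (O.chart x).proj y ∈ f.base x :=
  mem_image_of_mem _ hy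

theorem isOpen_base (x : X) : IsOpen (f.base x) :=
  (O.chart x).isOpen_image_proj _ (f.dom_subset x) (f.isSubchart_dom x).isOpen

theorem base_subset (hz : z ∈ f.base x) : z ∈ (O.chart x).proj '' (O.chart x).dom :=
  image_mono (f.dom_subset x) hz

theorem toFun_mem_image (hz : z ∈ f.base x) :
    f.toFun z ∈ (P.chart (f.toFun x)).proj '' (P.chart (f.toFun x)).dom := by
  obtain ⟨y, hy, rfl⟩ := hz
  exact ⟨f.lift x y, f.mapsTo_lift x hy, f.proj_lift x y hy⟩

theorem mem_dom_of_proj_mem_base {y : Eu n} (hy : y ∈ (O.chart x).dom)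
    (h : (O.chart x).proj y ∈ f.base x) : y ∈ f.dom x := by
  obtain ⟨y', hy', he⟩ := h
  obtain ⟨γ, rfl⟩ := ((O.chart x).proj_eq_iff _ (f.dom_subset x hy') _ hy).1 he
  exact f.act_mem_dom γ hy'

theorem ψ_mem_dom (hz : z ∈ f.base x) {y : Eu n} (hy : y ∈ (O.ψ z x).source)
    (h : (O.chart z).proj y ∈ f.base x) : O.ψ z x y ∈ f.dom x := by
  have hz' := f.base_subset hz
  refine f.mem_dom_of_proj_mem_base (O.target_subset z x hz' ((O.ψ z x).map_source hy)) ?_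
  rwa [O.proj_ψ z x hz' _ hy]

theorem ψ_center_mem_dom (hz : z ∈ f.base x) : O.ψ z x (O.chart z).center ∈ f.dom x := by
  apply f.ψ_mem_dom hz (O.center_mem_source z x (f.base_subset hz))
  rwa [(O.chart z).proj_center]

theorem exists_act_eq {y y' : Eu n} (hy : y ∈ f.dom x) (hy' : y' ∈ f.dom x)
    (h : (O.chart x).proj y = (O.chart x).proj y') : ∃ γ, (O.chart x).act γ y = y' :=
  ((O.chart x).proj_eq_iff _ (f.dom_subset x hy) _ (f.dom_subset x hy')).1 h

theorem exists_act_ψ_center_eq {y : Eu n} (hy : y ∈ f.dom x) (h : (O.chart x).proj y = w) :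
    ∃ γ, (O.chart x).act γ (O.ψ w x (O.chart w).center) = y := by
  have hw : w ∈ f.base x := h ▸ f.proj_mem_base hy
  exact f.exists_act_eq (f.ψ_center_mem_dom hw) hy
    (by rw [O.proj_ψ_center (f.base_subset hw), h])

theorem lift_center (x : X) : f.lift x (O.chart x).center = (P.chart (f.toFun x)).center := by
  have hc := f.center_mem_dom x
  obtain ⟨γ, hγ⟩ := ((P.chart (f.toFun x)).proj_eq_iff _ (P.chart (f.toFun x)).center_mem _
    (f.mapsTo_lift x hc)).1
    (by rw [f.proj_lift x _ hc, (P.chart (f.toFun x)).proj_center, (O.chart x).proj_center])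
  rw [← hγ, (P.chart (f.toFun x)).act_center]

theorem contDiffAt_lift {y : Eu n} (hy : y ∈ f.dom x) :
    ContDiffAt ℝ (k : WithTop ℕ∞) (f.lift x) y :=
  (f.contDiffOn_lift x).contDiffAt (f.dom_mem_nhds hy)

theorem continuousAt_lift {y : Eu n} (hy : y ∈ f.dom x) : ContinuousAt (f.lift x) y :=
  (f.contDiffAt_lift hy).continuousAt

theorem continuousAt_proj {y : Eu n} (hy : y ∈ f.dom x) : ContinuousAt (O.chart x).proj y :=
  (O.chart x).continuousOn_proj.continuousAt ((O.chart x).isOpen_dom.mem_nhds (f.dom_subset x hy))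

theorem lift_center_mem_source (hz : z ∈ f.base x) :
    f.lift z (O.chart z).center ∈ (P.ψ (f.toFun z) (f.toFun x)).source := by
  rw [f.lift_center]
  exact P.center_mem_source _ _ (f.toFun_mem_image hz)

namespace Transitions

variable {f} (T : f.Transitions)

theorem contDiffAt_η (hz : z ∈ f.base x) {u : Eu m}
    (hu : u ∈ (P.ψ (f.toFun z) (f.toFun x)).source) :
    ContDiffAt ℝ (k : WithTop ℕ∞) (T.η z x) u := by
  have hz' := f.toFun_mem_image hz
  exact ((P.chart (f.toFun x)).contDiffAt_act (T.ε z x) (P.target_subset _ _ hz'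
    ((P.ψ (f.toFun z) (f.toFun x)).map_source hu))).comp u (P.contDiffAt_ψ hz' hu)

theorem η_mem_dom (hz : z ∈ f.base x) {u : Eu m}
    (hu : u ∈ (P.ψ (f.toFun z) (f.toFun x)).source) :
    T.η z x u ∈ (P.chart (f.toFun x)).dom :=
  (P.chart (f.toFun x)).mapsTo_act _ (P.target_subset _ _ (f.toFun_mem_image hz)
    ((P.ψ (f.toFun z) (f.toFun x)).map_source hu))

/-- The inverse of the chart change `η_zx`. -/
def ηInv (z x : X) : Eu m → Eu m := fun u =>
  (P.ψ (f.toFun z) (f.toFun x)).symm ((P.chart (f.toFun x)).act (T.ε z x)⁻¹ u)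

theorem act_inv_η (hz : z ∈ f.base x) {u : Eu m}
    (hu : u ∈ (P.ψ (f.toFun z) (f.toFun x)).source) :
    (P.chart (f.toFun x)).act (T.ε z x)⁻¹ (T.η z x u) = P.ψ (f.toFun z) (f.toFun x) u :=
  (P.chart (f.toFun x)).act_inv_act _ (P.target_subset _ _ (f.toFun_mem_image hz)
    ((P.ψ (f.toFun z) (f.toFun x)).map_source hu))

theorem ηInv_η (hz : z ∈ f.base x) {u : Eu m}
    (hu : u ∈ (P.ψ (f.toFun z) (f.toFun x)).source) : T.ηInv z x (T.η z x u) = u := by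
  rw [ηInv, T.act_inv_η hz hu, (P.ψ (f.toFun z) (f.toFun x)).left_inv hu]

theorem contDiffAt_ηInv (hz : z ∈ f.base x) {u : Eu m}
    (hu : u ∈ (P.ψ (f.toFun z) (f.toFun x)).source) :
    ContDiffAt ℝ (k : WithTop ℕ∞) (T.ηInv z x) (T.η z x u) := by
  refine ContDiffAt.comp _ ?_ ((P.chart (f.toFun x)).contDiffAt_act _ (T.η_mem_dom hz hu))
  rw [T.act_inv_η hz hu]
  exact P.contDiffAt_ψ_symm (f.toFun_mem_image hz) ((P.ψ (f.toFun z) (f.toFun x)).map_source hu)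

theorem eventually_η_ηInv (hz : z ∈ f.base x) {u : Eu m}
    (hu : u ∈ (P.ψ (f.toFun z) (f.toFun x)).source) :
    ∀ᶠ u' in 𝓝 (T.η z x u), T.η z x (T.ηInv z x u') = u' := by
  have hd := T.η_mem_dom hz hu
  have h1 : ∀ᶠ u' in 𝓝 (T.η z x u), (P.chart (f.toFun x)).act (T.ε z x)⁻¹ u' ∈
      (P.ψ (f.toFun z) (f.toFun x)).target := by
    apply (P.chart (f.toFun x)).continuousAt_act _ hd
    rw [T.act_inv_η hz hu]
    exact (P.ψ (f.toFun z) (f.toFun x)).open_target.mem_nhds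
      ((P.ψ (f.toFun z) (f.toFun x)).map_source hu)
  filter_upwards [h1, (P.chart (f.toFun x)).isOpen_dom.mem_nhds hd] with u' hu' hud
  change (P.chart (f.toFun x)).act (T.ε z x) (P.ψ (f.toFun z) (f.toFun x) (T.ηInv z x u')) = u'
  rw [ηInv, (P.ψ (f.toFun z) (f.toFun x)).right_inv hu', (P.chart (f.toFun x)).act_act_inv _ hud]

theorem tendsto_ηInv (hz : z ∈ f.base x) {u : Eu m}
    (hu : u ∈ (P.ψ (f.toFun z) (f.toFun x)).source) :
    Tendsto (T.ηInv z x) (𝓝 (T.η z x u)) (𝓝 u) := by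
  have h := (T.contDiffAt_ηInv hz hu).continuousAt
  rwa [ContinuousAt, T.ηInv_η hz hu] at h

theorem differentiableAt_η (hk : 1 ≤ k) (hz : z ∈ f.base x) {u : Eu m}
    (hu : u ∈ (P.ψ (f.toFun z) (f.toFun x)).source) : DifferentiableAt ℝ (T.η z x) u :=
  (T.contDiffAt_η hz hu).differentiableAt (coe_withTop_ne_zero_of_one_le hk)

theorem fderiv_ηInv_fderiv_η (hk : 1 ≤ k) (hz : z ∈ f.base x) {u : Eu m}
    (hu : u ∈ (P.ψ (f.toFun z) (f.toFun x)).source) (v : Eu m) :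
    fderiv ℝ (T.ηInv z x) (T.η z x u) (fderiv ℝ (T.η z x) u v) = v := by
  have h : T.ηInv z x ∘ T.η z x =ᶠ[𝓝 u] id := by
    filter_upwards [(P.ψ (f.toFun z) (f.toFun x)).open_source.mem_nhds hu] with u' hu'
    exact T.ηInv_η hz hu'
  have h2 := fderiv_comp u ((T.contDiffAt_ηInv hz hu).differentiableAt
    (coe_withTop_ne_zero_of_one_le hk)) (T.differentiableAt_η hk hz hu)
  rw [h.fderiv_eq, fderiv_id] at h2
  exact (DFunLike.congr_fun h2 v).symm

theorem fderiv_η_fderiv_ηInv (hk : 1 ≤ k) (hz : z ∈ f.base x) {u : Eu m}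
    (hu : u ∈ (P.ψ (f.toFun z) (f.toFun x)).source) (v : Eu m) :
    fderiv ℝ (T.η z x) u (fderiv ℝ (T.ηInv z x) (T.η z x u) v) = v := by
  have h : T.η z x ∘ T.ηInv z x =ᶠ[𝓝 (T.η z x u)] id := T.eventually_η_ηInv hz hu
  have hd : DifferentiableAt ℝ (T.η z x) (T.ηInv z x (T.η z x u)) := by
    rw [T.ηInv_η hz hu]; exact T.differentiableAt_η hk hz hu
  have h2 := fderiv_comp (T.η z x u) hd ((T.contDiffAt_ηInv hz hu).differentiableAt
    (coe_withTop_ne_zero_of_one_le hk))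
  rw [h.fderiv_eq, fderiv_id, T.ηInv_η hz hu] at h2
  exact (DFunLike.congr_fun h2 v).symm

theorem η_act (hz : z ∈ f.base x) (γ : (O.chart z).Γ) {u : Eu m}
    (hu : u ∈ (P.ψ (f.toFun z) (f.toFun x)).source) :
    T.η z x ((P.chart (f.toFun z)).act (f.Θ z γ) u) =
      (P.chart (f.toFun x)).act (f.Θ x (O.θ z x γ)) (T.η z x u) := by
  have hz' := f.toFun_mem_image hz
  have hd := P.target_subset _ _ hz' ((P.ψ (f.toFun z) (f.toFun x)).map_source hu)
  change (P.chart (f.toFun x)).act (T.ε z x) (P.ψ (f.toFun z) (f.toFun x) _) =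
    (P.chart (f.toFun x)).act _ ((P.chart (f.toFun x)).act (T.ε z x) _)
  rw [P.ψ_act _ _ hz' _ _ hu, ← (P.chart (f.toFun x)).act_mul _ _ _ hd,
    ← (P.chart (f.toFun x)).act_mul _ _ _ hd, T.Θ_θ z x hz]

theorem fderiv_η_act (hk : 1 ≤ k) (hz : z ∈ f.base x) (γ : (O.chart z).Γ) {u : Eu m}
    (hu : u ∈ (P.ψ (f.toFun z) (f.toFun x)).source) (v : Eu m) :
    fderiv ℝ (T.η z x) ((P.chart (f.toFun z)).act (f.Θ z γ) u)
        (fderiv ℝ ((P.chart (f.toFun z)).act (f.Θ z γ)) u v) =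
      fderiv ℝ ((P.chart (f.toFun x)).act (f.Θ x (O.θ z x γ))) (T.η z x u)
        (fderiv ℝ (T.η z x) u v) := by
  have hz' := f.toFun_mem_image hz
  have hu' := P.mapsTo_act_source _ _ hz' (f.Θ z γ) hu
  have h : T.η z x ∘ (P.chart (f.toFun z)).act (f.Θ z γ) =ᶠ[𝓝 u]
      (P.chart (f.toFun x)).act (f.Θ x (O.θ z x γ)) ∘ T.η z x := by
    filter_upwards [(P.ψ (f.toFun z) (f.toFun x)).open_source.mem_nhds hu] with u' hu'
    exact T.η_act hz γ hu'
  have h2 := h.fderiv_eq (𝕜 := ℝ)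
  rw [fderiv_comp _ (T.differentiableAt_η hk hz hu')
    ((P.chart (f.toFun z)).differentiableAt_act hk _ (P.source_subset _ _ hz' hu)),
    fderiv_comp _ ((P.chart (f.toFun x)).differentiableAt_act hk _ (T.η_mem_dom hz hu))
    (T.differentiableAt_η hk hz hu)] at h2
  exact DFunLike.congr_fun h2 v

theorem lift_ψ_center (hz : z ∈ f.base x) :
    f.lift x (O.ψ z x (O.chart z).center) = T.η z x (f.lift z (O.chart z).center) :=
  (T.lift_ψ z x hz).self_of_nhds

theorem bundleAct_mul (hk : 1 ≤ k) (γ δ : (O.chart x).Γ) {q : Eu n × Eu m} (hq : q.1 ∈ f.dom x) :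
    T.bundleAct x (γ * δ) q = T.bundleAct x γ (T.bundleAct x δ q) := by
  ext1
  · exact (O.chart x).act_mul _ _ _ (f.dom_subset x hq)
  · simp only [bundleAct]
    rw [map_mul, (P.chart (f.toFun x)).fderiv_act_mul hk _ _ (f.mapsTo_lift x hq),
      f.lift_act x δ _ hq]
    rfl

theorem bundleAct_one {q : Eu n × Eu m} (hq : q.1 ∈ f.dom x) : T.bundleAct x 1 q = q := by
  ext1
  · exact (O.chart x).act_one _ (f.dom_subset x hq)
  · simp only [bundleAct]
    rw [map_one, (P.chart (f.toFun x)).fderiv_act_one (f.mapsTo_lift x hq)]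
    rfl

theorem bundleAct_inv_bundleAct (hk : 1 ≤ k) (γ : (O.chart x).Γ) {q : Eu n × Eu m}
    (hq : q.1 ∈ f.dom x) : T.bundleAct x γ⁻¹ (T.bundleAct x γ q) = q := by
  rw [← T.bundleAct_mul hk _ _ hq, inv_mul_cancel, T.bundleAct_one hq]

theorem bundleAct_bundleAct_inv (hk : 1 ≤ k) (γ : (O.chart x).Γ) {q : Eu n × Eu m}
    (hq : q.1 ∈ f.dom x) : T.bundleAct x γ (T.bundleAct x γ⁻¹ q) = q := by
  rw [← T.bundleAct_mul hk _ _ hq, mul_inv_cancel, T.bundleAct_one hq]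

theorem bundleAct_center (γ : (O.chart x).Γ) (v : Eu m) :
    T.bundleAct x γ ((O.chart x).center, v) =
      ((O.chart x).center, (T.bundleAct x γ ((O.chart x).center, v)).2) :=
  Prod.ext ((O.chart x).act_center γ) rfl

theorem bundleψ_bundleAct_center (hk : 1 ≤ k) (hz : z ∈ f.base x) (γ : (O.chart z).Γ) (v : Eu m) :
    T.bundleψ z x (T.bundleAct z γ ((O.chart z).center, v)) =
      T.bundleAct x (O.θ z x γ) (T.bundleψ z x ((O.chart z).center, v)) := by
  ext1
  · exact O.ψ_act z x (f.base_subset hz) γ _ (O.center_mem_source z x (f.base_subset hz))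
  · simp only [bundleAct, bundleψ]
    rw [f.lift_act z γ _ (f.center_mem_dom z), T.lift_ψ_center hz]
    exact T.fderiv_η_act hk hz γ (f.lift_center_mem_source hz) v

theorem bundleψ_center_injective (hk : 1 ≤ k) (hz : z ∈ f.base x) :
    Function.Injective fun v => T.bundleψ z x ((O.chart z).center, v) := fun _ _ h =>
  (Function.LeftInverse.injective fun v =>
    T.fderiv_ηInv_fderiv_η hk hz (f.lift_center_mem_source hz) v) (congrArg Prod.snd h)

theorem exists_bundleψ_center_eq (hk : 1 ≤ k) (hz : z ∈ f.base x) {q : Eu n × Eu m}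
    (hq : q.1 = O.ψ z x (O.chart z).center) :
    ∃ v, T.bundleψ z x ((O.chart z).center, v) = q :=
  ⟨_, Prod.ext hq.symm (T.fderiv_η_fderiv_ηInv hk hz (f.lift_center_mem_source hz) q.2)⟩

theorem eventuallyEq_act_of_η_comp_self {δ : (O.chart x).Γ}
    (h : ∀ᶠ u in 𝓝 (P.chart (f.toFun x)).center,
      T.η x x (T.η x x u) = (P.chart (f.toFun x)).act (f.Θ x δ) (T.η x x u)) :
    T.η x x =ᶠ[𝓝 (f.lift x (O.chart x).center)] (P.chart (f.toFun x)).act (f.Θ x δ) := by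
  have hx := f.mem_base_self x
  have hs := f.lift_center_mem_source hx
  have hη : T.η x x (f.lift x (O.chart x).center) = f.lift x (O.chart x).center := by
    rw [← T.lift_ψ_center hx, O.ψ_self_center x]
  have hinv := T.eventually_η_ηInv hx hs
  have ht := T.tendsto_ηInv hx hs
  rw [hη] at hinv ht
  rw [← f.lift_center] at h
  exact eventuallyEq_of_comp_right ht hinv h

/-- The cocycle condition for `ψ_xx ∘ ψ_xx` and `η_xx ∘ η_xx` can be cancelled on the right. -/
theorem exists_bundleψ_self_eq (x : X) : ∃ δ, ∀ᶠ u in 𝓝 (O.chart x).center,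
    ∀ v, T.bundleψ x x (u, v) = T.bundleAct x δ (u, v) := by
  have hx := f.mem_base_self x
  have hsrc := O.center_mem_source x x (f.base_subset hx)
  obtain ⟨δ, hψ, hη⟩ := (T.cocycle x x hx).self_of_nhds x (O.chart x).proj_center.symm
  have hψ' : O.ψ x x =ᶠ[𝓝 (O.chart x).center] (O.chart x).act δ := by
    have ht := (O.ψ x x).tendsto_symm hsrc
    have hinv := (O.ψ x x).eventually_right_inverse' hsrc
    rw [O.ψ_self_center x] at ht hinv
    exact eventuallyEq_of_comp_right ht hinv hψ
  have hη' := (T.eventuallyEq_act_of_η_comp_self hη).eventuallyEq_nhds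
  refine ⟨δ, ?_⟩
  filter_upwards [hψ', (f.continuousAt_lift (f.center_mem_dom x)).eventually hη'] with u hu hu' v
  exact Prod.ext hu (DFunLike.congr_fun hu'.fderiv_eq v)

/-- The vectors over `w̃` in the chart at `w` which are identified with the given point of a chart
of the pullback: an invariant of the gluing relation, which thereby decides when two points are
identified. -/
def fibreVectors (p : T.Pre) (w : X) : Set (Eu m) :=
  {u | (O.chart p.1).proj p.2.1 = w ∧
    ∃ γ, ((p.2.1 : Eu n), p.2.2) = T.bundleAct p.1 γ (T.bundleψ w p.1 ((O.chart w).center, u))}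

theorem fibreVectors_subset_of_act (hk : 1 ≤ k) (γ : (O.chart x).Γ) (y y' : f.dom x)
    (v v' : Eu m) (h : ((y' : Eu n), v') = T.bundleAct x γ ((y : Eu n), v)) (w : X) :
    T.fibreVectors ⟨x, (y, v)⟩ w ⊆ T.fibreVectors ⟨x, (y', v')⟩ w := by
  rintro u ⟨hw, δ, hδ⟩
  have hw' : w ∈ f.base x := hw ▸ f.proj_mem_base y.2
  refine ⟨?_, γ * δ, ?_⟩
  · rw [← hw]
    exact (((O.chart x).proj_eq_iff _ (f.dom_subset x y.2) _ (f.dom_subset x y'.2)).2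
      ⟨γ, (congrArg Prod.fst h).symm⟩).symm
  · rw [T.bundleAct_mul hk _ _ (f.ψ_center_mem_dom hw'), ← hδ]
    exact h

theorem mem_fibreVectors_center (hk : 1 ≤ k) {u v : Eu m} :
    u ∈ T.fibreVectors ⟨w, (⟨(O.chart w).center, f.center_mem_dom w⟩, v)⟩ w ↔
      ∃ γ, ((O.chart w).center, v) = T.bundleAct w γ ((O.chart w).center, u) := by
  obtain ⟨δ, hδ⟩ := T.exists_bundleψ_self_eq w
  have hδ := hδ.self_of_nhds u
  have hmul (γ : (O.chart w).Γ) := T.bundleAct_mul hk γ δ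
    (q := ((O.chart w).center, u)) (f.center_mem_dom w)
  constructor
  · rintro ⟨-, γ, hγ⟩
    exact ⟨γ * δ, by rw [hmul, ← hδ]; exact hγ⟩
  · rintro ⟨γ, hγ⟩
    refine ⟨(O.chart w).proj_center, γ * δ⁻¹, ?_⟩
    rw [hδ, ← T.bundleAct_mul hk _ _ (f.center_mem_dom w), inv_mul_cancel_right]
    exact hγ

theorem mem_fibreVectors_of_eq_bundleψ (hk : 1 ≤ k) (hw : w ∈ f.base x) {y : f.dom x}
    {u v v' : Eu m} (h : ((y : Eu n), v') = T.bundleψ w x ((O.chart w).center, v)) :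
    u ∈ T.fibreVectors ⟨x, (y, v')⟩ w ↔
      ∃ γ, ((O.chart w).center, v) = T.bundleAct w γ ((O.chart w).center, u) := by
  have hy : (y : Eu n) = O.ψ w x (O.chart w).center := congrArg Prod.fst h
  constructor
  · rintro ⟨-, δ, hδ⟩
    have hδ : T.bundleψ w x ((O.chart w).center, v) =
      T.bundleAct x δ (T.bundleψ w x ((O.chart w).center, u)) := h.symm.trans hδ
    obtain ⟨γ, rfl⟩ := O.exists_θ_eq_of_act_ψ_center hk (f.base_subset hw) (δ := δ)
      (congrArg Prod.fst hδ).symm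
    rw [← T.bundleψ_bundleAct_center hk hw, T.bundleAct_center] at hδ
    exact ⟨γ, by rw [T.bundleAct_center, T.bundleψ_center_injective hk hw hδ]⟩
  · rintro ⟨γ, hγ⟩
    refine ⟨by rw [hy, O.proj_ψ_center (f.base_subset hw)], O.θ w x γ, ?_⟩
    rw [← T.bundleψ_bundleAct_center hk hw, ← hγ]
    exact h

theorem fibreVectors_eq_of_rel (hk : 1 ≤ k) {p q : T.Pre} (h : T.Rel p q) :
    T.fibreVectors p = T.fibreVectors q := by
  funext w
  cases h with
  | act x γ y y' v v' h =>
    refine (T.fibreVectors_subset_of_act hk γ y y' v v' h w).antisymm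
      (T.fibreVectors_subset_of_act hk γ⁻¹ y' y v' v ?_ w)
    rw [h, T.bundleAct_inv_bundleAct hk γ y.2]
  | change w₀ x hw₀ y y' v v' hy h =>
    obtain ⟨y, hyd⟩ := y
    subst hy
    have hproj : (O.chart x).proj y' = w₀ :=
      (congrArg (O.chart x).proj (congrArg Prod.fst h)).trans
        (O.proj_ψ_center (f.base_subset hw₀))
    rcases eq_or_ne w₀ w with rfl | hne
    · ext u
      rw [T.mem_fibreVectors_center hk, T.mem_fibreVectors_of_eq_bundleψ hk hw₀ h]
    · ext u
      exact iff_of_false (fun hu => hne ((O.chart w₀).proj_center.symm.trans hu.1))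
        fun hu => hne (hproj.symm.trans hu.1)

theorem exists_bundleAct_eq_of_toTotal_eq (hk : 1 ≤ k) {q q' : Eu n × Eu m} {h : q.1 ∈ f.dom x}
    {h' : q'.1 ∈ f.dom x} (he : T.toTotal x q h = T.toTotal x q' h') :
    ∃ γ, q' = T.bundleAct x γ q := by
  have hfib : T.fibreVectors ⟨x, (⟨q.1, h⟩, q.2)⟩ = T.fibreVectors ⟨x, (⟨q'.1, h'⟩, q'.2)⟩ :=
    congrArg (Quot.lift T.fibreVectors fun _ _ => T.fibreVectors_eq_of_rel hk) he
  obtain ⟨w, hw⟩ : ∃ w, (O.chart x).proj q.1 = w := ⟨_, rfl⟩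
  have hwx : w ∈ f.base x := hw ▸ f.proj_mem_base h
  have hpd := f.ψ_center_mem_dom hwx
  obtain ⟨γ, hγ⟩ := f.exists_act_ψ_center_eq h hw
  obtain ⟨u, hu⟩ := T.exists_bundleψ_center_eq hk hwx (q := T.bundleAct x γ⁻¹ q)
    (by change (O.chart x).act γ⁻¹ q.1 = _
        rw [← hγ, (O.chart x).act_inv_act _ (f.dom_subset x hpd)])
  have hmem : u ∈ T.fibreVectors ⟨x, (⟨q.1, h⟩, q.2)⟩ w :=
    ⟨hw, γ, by rw [hu, T.bundleAct_bundleAct_inv hk _ h]⟩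
  rw [hfib] at hmem
  obtain ⟨-, γ', hγ'⟩ := hmem
  exact ⟨γ' * γ⁻¹, by rw [T.bundleAct_mul hk _ _ h, ← hu]; exact hγ'⟩

theorem toTotal_bundleAct (γ : (O.chart x).Γ) {q : Eu n × Eu m} (h : q.1 ∈ f.dom x)
    (h' : (T.bundleAct x γ q).1 ∈ f.dom x) :
    T.toTotal x (T.bundleAct x γ q) h' = T.toTotal x q h :=
  (Quot.sound (Rel.act x γ ⟨q.1, h⟩ ⟨_, h'⟩ q.2 _ rfl)).symm

theorem toTotal_bundleψ_center (hw : w ∈ f.base x) (v : Eu m)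
    (h' : (T.bundleψ w x ((O.chart w).center, v)).1 ∈ f.dom x) :
    T.toTotal x (T.bundleψ w x ((O.chart w).center, v)) h' =
      T.toTotal w ((O.chart w).center, v) (f.center_mem_dom w) :=
  (Quot.sound (Rel.change w x hw ⟨_, f.center_mem_dom w⟩ ⟨_, h'⟩ v _ rfl rfl)).symm

end Transitions

end CompleteOrbifoldMap

/-! ### Orbisections and their local representatives -/

theorem OrbifoldChart.continuousAt_of_comp_proj {n : ℕ} {k : ℕ∞} {X Z : Type*} [TopologicalSpace X]
    [TopologicalSpace Z] {x : X} (c : OrbifoldChart n k X x) {g : X → Z}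
    (h : ContinuousAt (g ∘ c.proj) c.center) : ContinuousAt g x := by
  intro V hV
  rw [← c.proj_center] at hV
  obtain ⟨U, hUV, hU, hcU⟩ := mem_nhds_iff.1 (h hV)
  have hopen := c.isOpen_image_proj (U ∩ c.dom) inter_subset_right (hU.inter c.isOpen_dom)
  refine mem_map.2 (mem_of_superset (hopen.mem_nhds ⟨_, ⟨hcU, c.center_mem⟩, c.proj_center⟩) ?_)
  rintro _ ⟨u, hu, rfl⟩
  exact hUV hu.1

namespace CompleteOrbifoldMap

variable {n m : ℕ} {k r : ℕ∞} {X Y : Type*} [TopologicalSpace X] [TopologicalSpace Y]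
  {O : Orbifold n k X} {P : Orbifold m k Y} {f : CompleteOrbifoldMap O P} {w z x : X}

theorem eventually_proj_mem_base (hz : z ∈ f.base x) :
    ∀ᶠ y in 𝓝 (O.chart z).center, (O.chart z).proj y ∈ f.base x := by
  apply f.continuousAt_proj (f.center_mem_dom z)
  rw [(O.chart z).proj_center]
  exact (f.isOpen_base x).mem_nhds hz

theorem eventually_lift_mem_source (hz : z ∈ f.base x) :
    ∀ᶠ y in 𝓝 (O.chart z).center, f.lift z y ∈ (P.ψ (f.toFun z) (f.toFun x)).source :=
  f.continuousAt_lift (f.center_mem_dom z)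
    ((P.ψ (f.toFun z) (f.toFun x)).open_source.mem_nhds (f.lift_center_mem_source hz))

namespace Transitions

variable (T : f.Transitions)

/-- A family `s` consists of the local representatives of a `C^r` orbisection: it is equivariant and
compatible with the chart changes. Compatibility is only demanded at the centre of the smaller
chart, where the pullback is glued. -/
structure IsCompatible (r : ℕ∞) (s : X → Eu n → Eu m) : Prop where
  eq_zero : ∀ x, ∀ y, y ∉ f.dom x → s x y = 0
  contDiffOn : ∀ x, ContDiffOn ℝ (r : WithTop ℕ∞) (s x) (f.dom x)
  act : ∀ x γ, ∀ y ∈ f.dom x, s x ((O.chart x).act γ y) =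
    fderiv ℝ ((P.chart (f.toFun x)).act (f.Θ x γ)) (f.lift x y) (s x y)
  ψ_center : ∀ w x, w ∈ f.base x → s x (O.ψ w x (O.chart w).center) =
    fderiv ℝ (T.η w x) (f.lift w (O.chart w).center) (s w (O.chart w).center)

/-- The vector space of compatible families of local representatives. -/
noncomputable def sectionSpace (r : ℕ∞) : Submodule ℝ (X → Eu n → Eu m) where
  carrier := {s | T.IsCompatible r s}
  zero_mem' := ⟨fun _ _ _ => rfl, fun _ => contDiffOn_const, fun _ _ _ _ => by simp,
    fun _ _ _ => by simp⟩
  add_mem' {s t} hs ht :=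
    { eq_zero x y hy := by simp [hs.eq_zero x y hy, ht.eq_zero x y hy]
      contDiffOn x := (hs.contDiffOn x).add (ht.contDiffOn x)
      act x γ y hy := by simp [hs.act x γ y hy, ht.act x γ y hy]
      ψ_center w x hw := by simp [hs.ψ_center w x hw, ht.ψ_center w x hw] }
  smul_mem' a s hs :=
    { eq_zero x y hy := by simp [hs.eq_zero x y hy]
      contDiffOn x := (hs.contDiffOn x).const_smul a
      act x γ y hy := by simp [hs.act x γ y hy]
      ψ_center w x hw := by simp [hs.ψ_center w x hw] }

variable {T}

namespace Orbisection

variable (σ : T.Orbisection r)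

/-- As `Γ_x` acts effectively, `pr₁ ∘ σ̃_x = Id` forces the homomorphism in `σ.equivariant` to be
the identity. -/
theorem repr_act (γ : (O.chart x).Γ) {y : Eu n} (hy : y ∈ f.dom x) :
    σ.repr x ((O.chart x).act γ y) =
      fderiv ℝ ((P.chart (f.toFun x)).act (f.Θ x γ)) (f.lift x y) (σ.repr x y) := by
  obtain ⟨Θ', hΘ'⟩ := σ.equivariant x
  have hγ : Θ' γ = γ := by
    apply inv_mul_eq_one.1
    apply (f.isSubchart_dom x).effective
    intro u hu
    have hact : (O.chart x).act γ u = (O.chart x).act (Θ' γ) u := congrArg Prod.fst (hΘ' γ u hu)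
    rw [(O.chart x).act_mul _ _ _ (f.dom_subset x hu), hact,
      (O.chart x).act_inv_act _ (f.dom_subset x hu)]
  have h := congrArg Prod.snd (hΘ' γ y hy)
  rwa [hγ] at h

theorem bundleAct_repr (γ : (O.chart x).Γ) {y : Eu n} (hy : y ∈ f.dom x) :
    T.bundleAct x γ (y, σ.repr x y) =
      ((O.chart x).act γ y, σ.repr x ((O.chart x).act γ y)) := by
  rw [σ.repr_act γ hy]
  rfl

theorem eq_repr_of_toTotal_eq (hk : 1 ≤ k) {y : Eu n} (hy : y ∈ f.dom x) {v : Eu m}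
    (h : T.toTotal x (y, v) hy = σ.toFun ((O.chart x).proj y)) : v = σ.repr x y := by
  rw [← σ.toTotal_repr x y hy] at h
  obtain ⟨γ, hγ⟩ := T.exists_bundleAct_eq_of_toTotal_eq hk h.symm
  rw [σ.bundleAct_repr γ hy, Prod.mk.injEq] at hγ
  rw [hγ.2, ← hγ.1]

theorem toTotal_center (x : X) :
    T.toTotal x ((O.chart x).center, σ.repr x (O.chart x).center) (f.center_mem_dom x) =
      σ.toFun x := by
  rw [σ.toTotal_repr, (O.chart x).proj_center]

theorem repr_ψ_center (hk : 1 ≤ k) (hw : w ∈ f.base x) :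
    σ.repr x (O.ψ w x (O.chart w).center) =
      fderiv ℝ (T.η w x) (f.lift w (O.chart w).center) (σ.repr w (O.chart w).center) := by
  have hd := f.ψ_center_mem_dom hw
  refine (σ.eq_repr_of_toTotal_eq hk hd ?_).symm
  rw [O.proj_ψ_center (f.base_subset hw), ← σ.toTotal_center w]
  exact T.toTotal_bundleψ_center hw _ hd

theorem isCompatible_repr (hk : 1 ≤ k) : T.IsCompatible r σ.repr :=
  ⟨σ.repr_eq_zero, σ.contDiffOn_repr, fun _ γ _ hy => σ.repr_act γ hy,
    fun _ _ hw => σ.repr_ψ_center hk hw⟩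

theorem repr_injective : Function.Injective (repr : T.Orbisection r → X → Eu n → Eu m) :=
  fun σ τ h => Orbisection.ext (funext fun x => by
    rw [← σ.toTotal_center, ← τ.toTotal_center, h]) h

end Orbisection

namespace IsCompatible

variable {s : X → Eu n → Eu m}

theorem toTotal_eq (hs : T.IsCompatible r s) {y : Eu n} (hy : y ∈ f.dom x)
    (hw : (O.chart x).proj y = w) :
    T.toTotal x (y, s x y) hy =
      T.toTotal w ((O.chart w).center, s w (O.chart w).center) (f.center_mem_dom w) := by
  have hwx : w ∈ f.base x := hw ▸ f.proj_mem_base hy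
  obtain ⟨γ, rfl⟩ := f.exists_act_ψ_center_eq hy hw
  have hd := f.ψ_center_mem_dom hwx
  rw [← T.toTotal_bundleψ_center hwx (s w (O.chart w).center) hd,
    ← T.toTotal_bundleAct γ (q := T.bundleψ w x ((O.chart w).center, s w (O.chart w).center)) hd
      (f.act_mem_dom γ hd)]
  congr 1
  rw [hs.act x γ _ hd, hs.ψ_center w x hwx]
  rfl

theorem continuous_toTotal_center (hs : T.IsCompatible r s) : Continuous fun w =>
    T.toTotal w ((O.chart w).center, s w (O.chart w).center) (f.center_mem_dom w) := by
  refine continuous_iff_continuousAt.2 fun x => (O.chart x).continuousAt_of_comp_proj ?_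
  have hc : Continuous fun y : f.dom x => T.toTotal x ((y : Eu n), s x y) y.2 :=
    continuous_quot_mk.comp (continuous_sigmaMk.comp
      (continuous_id.prodMk (hs.contDiffOn x).continuousOn.domRestrict))
  refine (continuousOn_iff_continuous_domRestrict.2 (hc.congr fun y => ?_)).continuousAt
    (f.dom_mem_nhds (f.center_mem_dom x))
  exact hs.toTotal_eq y.2 rfl

/-- The orbisection with the given local representatives. -/
noncomputable def toOrbisection (hs : T.IsCompatible r s) : T.Orbisection r where
  toFun w := T.toTotal w ((O.chart w).center, s w (O.chart w).center) (f.center_mem_dom w)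
  continuous_toFun := hs.continuous_toTotal_center
  bundleProj_toFun w := (O.chart w).proj_center
  repr := s
  repr_eq_zero := hs.eq_zero
  contDiffOn_repr := hs.contDiffOn
  toTotal_repr x y hy := hs.toTotal_eq hy rfl
  equivariant x := ⟨MonoidHom.id _, fun γ y hy => by
    rw [hs.act x γ y hy]
    rfl⟩

end IsCompatible

variable (T) in
/-- Orbisections correspond to compatible families of local representatives. -/
noncomputable def orbisectionEquiv (hk : 1 ≤ k) (r : ℕ∞) : T.Orbisection r ≃ T.sectionSpace r where
  toFun σ := ⟨σ.repr, σ.isCompatible_repr hk⟩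
  invFun s := s.2.toOrbisection
  left_inv _ := Orbisection.repr_injective rfl
  right_inv _ := rfl

theorem fderiv_η_comp_η (hk : 1 ≤ k) (hz : z ∈ f.base x) (hwz : w ∈ f.base z) (hwx : w ∈ f.base x)
    (hP : f.lift z (O.ψ w z (O.chart w).center) ∈ (P.ψ (f.toFun z) (f.toFun x)).source)
    {δ : (O.chart x).Γ} (hδ : ∀ᶠ u in 𝓝 (P.chart (f.toFun w)).center,
      T.η z x (T.η w z u) = (P.chart (f.toFun x)).act (f.Θ x δ) (T.η w x u)) (v : Eu m) :
    fderiv ℝ (T.η z x) (f.lift z (O.ψ w z (O.chart w).center))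
        (fderiv ℝ (T.η w z) (f.lift w (O.chart w).center) v) =
      fderiv ℝ ((P.chart (f.toFun x)).act (f.Θ x δ)) (f.lift x (O.ψ w x (O.chart w).center))
        (fderiv ℝ (T.η w x) (f.lift w (O.chart w).center) v) := by
  have hwP := f.lift_center_mem_source hwz
  have hwP' := f.lift_center_mem_source hwx
  rw [← f.lift_center] at hδ
  have h : T.η z x ∘ T.η w z =ᶠ[𝓝 (f.lift w (O.chart w).center)]
    (P.chart (f.toFun x)).act (f.Θ x δ) ∘ T.η w x := hδ
  have h' := h.fderiv_eq (𝕜 := ℝ)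
  rw [T.lift_ψ_center hwz] at hP ⊢
  rw [fderiv_comp _ (T.differentiableAt_η hk hz hP) (T.differentiableAt_η hk hwz hwP),
    fderiv_comp _ ((P.chart (f.toFun x)).differentiableAt_act hk _ (T.η_mem_dom hwx hwP'))
      (T.differentiableAt_η hk hwx hwP'), ← T.lift_ψ_center hwx] at h'
  exact DFunLike.congr_fun h' v

namespace Orbisection

variable (σ : T.Orbisection r)

theorem repr_ψ_ψ_center (hk : 1 ≤ k) (hz : z ∈ f.base x) (hwz : w ∈ f.base z) (hwx : w ∈ f.base x)
    (hP : f.lift z (O.ψ w z (O.chart w).center) ∈ (P.ψ (f.toFun z) (f.toFun x)).source)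
    {δ : (O.chart x).Γ}
    (hψ : O.ψ z x (O.ψ w z (O.chart w).center) = (O.chart x).act δ (O.ψ w x (O.chart w).center))
    (hη : ∀ᶠ u in 𝓝 (P.chart (f.toFun w)).center,
      T.η z x (T.η w z u) = (P.chart (f.toFun x)).act (f.Θ x δ) (T.η w x u)) :
    σ.repr x (O.ψ z x (O.ψ w z (O.chart w).center)) =
      fderiv ℝ (T.η z x) (f.lift z (O.ψ w z (O.chart w).center))
        (σ.repr z (O.ψ w z (O.chart w).center)) := by
  rw [hψ, σ.repr_act δ (f.ψ_center_mem_dom hwx), σ.repr_ψ_center hk hwx, σ.repr_ψ_center hk hwz,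
    fderiv_η_comp_η hk hz hwz hwx hP hη]

theorem repr_ψ_act (hk : 1 ≤ k) (hz : z ∈ f.base x) {y : Eu n} (hyd : y ∈ f.dom z)
    (hys : y ∈ (O.ψ z x).source) (hyx : O.ψ z x y ∈ f.dom x)
    (hyP : f.lift z y ∈ (P.ψ (f.toFun z) (f.toFun x)).source)
    (hlift : f.lift x (O.ψ z x y) = T.η z x (f.lift z y))
    (h : σ.repr x (O.ψ z x y) = fderiv ℝ (T.η z x) (f.lift z y) (σ.repr z y))
    (γ : (O.chart z).Γ) :
    σ.repr x (O.ψ z x ((O.chart z).act γ y)) =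
      fderiv ℝ (T.η z x) (f.lift z ((O.chart z).act γ y))
        (σ.repr z ((O.chart z).act γ y)) := by
  rw [O.ψ_act z x (f.base_subset hz) γ _ hys, σ.repr_act _ hyx, h, σ.repr_act γ hyd,
    f.lift_act z γ _ hyd, T.fderiv_η_act hk hz γ hyP, hlift]

end Orbisection

theorem eventually_lift_ψ_act (T : f.Transitions) (hz : z ∈ f.base x) :
    ∀ᶠ y in 𝓝 (O.chart z).center, ∀ γ : (O.chart z).Γ,
      f.lift x (O.ψ z x ((O.chart z).act γ y)) = T.η z x (f.lift z ((O.chart z).act γ y)) := by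
  refine eventually_all.2 fun γ => ?_
  have h := (O.chart z).continuousAt_act γ (O.chart z).center_mem
  rw [ContinuousAt, (O.chart z).act_center] at h
  exact h.eventually (T.lift_ψ z x hz)

/-- Every `y` near the centre is in the orbit of some `ψ_wz(w̃)`, where the cocycle condition
reduces the claim to the gluing at the centre of the chart at `w`. -/
theorem eventually_repr_ψ (hk : 1 ≤ k) (T : f.Transitions) (r : ℕ∞) (hz : z ∈ f.base x) :
    ∀ᶠ y in 𝓝 (O.chart z).center, ∀ σ : T.Orbisection r,
      σ.repr x (O.ψ z x y) = fderiv ℝ (T.η z x) (f.lift z y) (σ.repr z y) := by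
  have hz' := f.base_subset hz
  filter_upwards [T.cocycle z x hz, f.eventually_proj_mem_base hz, f.eventually_lift_mem_source hz,
    T.eventually_lift_ψ_act hz, (O.ψ z x).open_source.mem_nhds (O.center_mem_source z x hz'),
    f.dom_mem_nhds (f.center_mem_dom z)] with y hcoc hyx hyP hlift hys hyd σ
  obtain ⟨w, hw⟩ : ∃ w, w = (O.chart z).proj y := ⟨_, rfl⟩
  have hwz : w ∈ f.base z := hw ▸ f.proj_mem_base hyd
  have hwx : w ∈ f.base x := hw ▸ hyx
  obtain ⟨δ, hψ, hη⟩ := hcoc w hw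
  obtain ⟨γ, rfl⟩ := f.exists_act_ψ_center_eq hyd hw.symm
  have hd := f.ψ_center_mem_dom hwz
  have hinv := (O.chart z).act_inv_act γ (f.dom_subset z hd)
  have hs : O.ψ w z (O.chart w).center ∈ (O.ψ z x).source :=
    hinv ▸ O.mapsTo_act_source z x hz' γ⁻¹ hys
  have hP : f.lift z (O.ψ w z (O.chart w).center) ∈ (P.ψ (f.toFun z) (f.toFun x)).source := by
    rw [← hinv, f.lift_act z _ _ hyd]
    exact P.mapsTo_act_source _ _ (f.toFun_mem_image hz) _ hyP
  refine σ.repr_ψ_act hk hz hd hs ?_ hP (hinv ▸ hlift γ⁻¹)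
    (σ.repr_ψ_ψ_center hk hz hwz hwx hP hψ.self_of_nhds hη) γ
  rw [hψ.self_of_nhds]
  exact f.act_mem_dom δ (f.ψ_center_mem_dom hwx)

end Transitions

end CompleteOrbifoldMap

/-! ### Closeness of derivatives and transfers -/

section IteratedDerivatives

variable {E E' F G : Type*} [NormedAddCommGroup E] [NormedSpace ℝ E] [NormedAddCommGroup E']
  [NormedSpace ℝ E'] [NormedAddCommGroup F] [NormedSpace ℝ F] [NormedAddCommGroup G]
  [NormedSpace ℝ G] {s : ℕ} {x : E}

theorem exists_isOpen_contDiffOn_of_contDiffAt {f : E → F} (hf : ContDiffAt ℝ s f x) :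
    ∃ U, IsOpen U ∧ x ∈ U ∧ ContDiffOn ℝ s f U := by
  obtain ⟨u, hu, hfu⟩ := hf.contDiffOn le_rfl (by simp)
  obtain ⟨U, hUu, hU, hxU⟩ := mem_nhds_iff.1 hu
  exact ⟨U, hU, hxU, hfu.mono hUu⟩

theorem norm_iteratedFDeriv_comp_le_of_contDiffAt {g : F → G} {f : E → F}
    (hg : ContDiffAt ℝ s g (f x)) (hf : ContDiffAt ℝ s f x) {C D : ℝ}
    (hC : ∀ i ≤ s, ‖iteratedFDeriv ℝ i g (f x)‖ ≤ C)
    (hD : ∀ i, 1 ≤ i → i ≤ s → ‖iteratedFDeriv ℝ i f x‖ ≤ D ^ i) :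
    ‖iteratedFDeriv ℝ s (g ∘ f) x‖ ≤ s.factorial * C * D ^ s := by
  obtain ⟨V, hV, hxV, hgV⟩ := exists_isOpen_contDiffOn_of_contDiffAt hg
  obtain ⟨U, hU, hxU, hfU⟩ := exists_isOpen_contDiffOn_of_contDiffAt hf
  have hW : IsOpen (U ∩ f ⁻¹' V) := hfU.continuousOn.isOpen_inter_preimage hU hV
  have hxW : x ∈ U ∩ f ⁻¹' V := ⟨hxU, hxV⟩
  have h := norm_iteratedFDerivWithin_comp_le (n := s) hgV (hfU.mono inter_subset_left) le_rfl
    hV.uniqueDiffOn hW.uniqueDiffOn (fun _ h => h.2) hxW (C := C) (D := D)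
    (fun i hi => by rw [iteratedFDerivWithin_of_isOpen i hV hxV]; exact hC i hi)
    (fun i h1 hi => by rw [iteratedFDerivWithin_of_isOpen i hW hxW]; exact hD i h1 hi)
  rwa [iteratedFDerivWithin_of_isOpen s hW hxW] at h

theorem norm_iteratedFDeriv_clm_apply_of_contDiffAt {f : E → F →L[ℝ] G} {g : E → F}
    (hf : ContDiffAt ℝ s f x) (hg : ContDiffAt ℝ s g x) :
    ‖iteratedFDeriv ℝ s (fun y => f y (g y)) x‖ ≤ ∑ i ∈ Finset.range (s + 1),
      (s.choose i : ℝ) * ‖iteratedFDeriv ℝ i f x‖ * ‖iteratedFDeriv ℝ (s - i) g x‖ := by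
  obtain ⟨V, hV, hxV, hgV⟩ := exists_isOpen_contDiffOn_of_contDiffAt hg
  obtain ⟨U, hU, hxU, hfU⟩ := exists_isOpen_contDiffOn_of_contDiffAt hf
  have hW := hU.inter hV
  have hxW : x ∈ U ∩ V := ⟨hxU, hxV⟩
  have h := norm_iteratedFDerivWithin_clm_apply (n := s) (hfU.mono inter_subset_left)
    (hgV.mono inter_subset_right) hW.uniqueDiffOn hxW le_rfl
  rw [iteratedFDerivWithin_of_isOpen s hW hxW] at h
  refine h.trans (le_of_eq (Finset.sum_congr rfl fun i _ => ?_))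
  rw [iteratedFDerivWithin_of_isOpen i hW hxW, iteratedFDerivWithin_of_isOpen (s - i) hW hxW]

theorem exists_eventually_norm_iteratedFDeriv_le {f : E → F}
    (hf : ContDiffAt ℝ s f x) :
    ∃ C : ℝ, 1 ≤ C ∧ ∀ᶠ u in 𝓝 x, ∀ i ≤ s, ‖iteratedFDeriv ℝ i f u‖ ≤ C := by
  refine ⟨1 + ∑ i ∈ Finset.range (s + 1), (‖iteratedFDeriv ℝ i f x‖ + 1), ?_, ?_⟩
  · have : 0 ≤ ∑ i ∈ Finset.range (s + 1), (‖iteratedFDeriv ℝ i f x‖ + 1) :=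
      Finset.sum_nonneg fun i _ => by positivity
    linarith
  have h : ∀ i : Fin (s + 1), ∀ᶠ u in 𝓝 x,
      ‖iteratedFDeriv ℝ i f u‖ < ‖iteratedFDeriv ℝ i f x‖ + 1 := by
    intro i
    have hc := (hf.continuousAt_iteratedFDeriv (k := i)
      (by exact_mod_cast Nat.lt_succ_iff.1 i.2)).norm
    exact hc.eventually_lt continuousAt_const (by simp)
  filter_upwards [eventually_all.2 h] with u hu i hi
  have h1 := hu ⟨i, Nat.lt_succ_of_le hi⟩
  have h2 : ‖iteratedFDeriv ℝ i f x‖ + 1 ≤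
      ∑ i ∈ Finset.range (s + 1), (‖iteratedFDeriv ℝ i f x‖ + 1) :=
    Finset.single_le_sum (f := fun i => ‖iteratedFDeriv ℝ i f x‖ + 1)
      (fun i _ => by positivity) (Finset.mem_range.2 (Nat.lt_succ_of_le hi))
  simp only at h1
  linarith

theorem norm_iteratedFDeriv_comp_le_of_forall_le {g : F → G} {f : E → F}
    (hg : ContDiffAt ℝ s g (f x)) (hf : ContDiffAt ℝ s f x) {C D : ℝ} (hD1 : 1 ≤ D)
    (hC : ∀ i ≤ s, ‖iteratedFDeriv ℝ i g (f x)‖ ≤ C) (hD : ∀ i ≤ s, ‖iteratedFDeriv ℝ i f x‖ ≤ D)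
    {j : ℕ} (hj : j ≤ s) : ‖iteratedFDeriv ℝ j (g ∘ f) x‖ ≤ s.factorial * C * D ^ s := by
  have hC0 : 0 ≤ C := (norm_nonneg _).trans (hC 0 (Nat.zero_le _))
  have hj' : (j : WithTop ℕ∞) ≤ s := by exact_mod_cast hj
  calc ‖iteratedFDeriv ℝ j (g ∘ f) x‖ ≤ j.factorial * C * D ^ j :=
        norm_iteratedFDeriv_comp_le_of_contDiffAt (hg.of_le hj') (hf.of_le hj')
          (fun i hi => hC i (hi.trans hj))
          (fun i hi1 hi => (hD i (hi.trans hj)).trans (le_self_pow₀ hD1 (by omega)))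
    _ ≤ s.factorial * C * D ^ s := by gcongr

theorem norm_iteratedFDeriv_clm_apply_le_of_forall_le {f : E → F →L[ℝ] G} {g : E → F}
    (hf : ContDiffAt ℝ s f x) (hg : ContDiffAt ℝ s g x) {B C : ℝ}
    (hB : ∀ i ≤ s, ‖iteratedFDeriv ℝ i f x‖ ≤ B) (hC : ∀ i ≤ s, ‖iteratedFDeriv ℝ i g x‖ ≤ C)
    {j : ℕ} (hj : j ≤ s) : ‖iteratedFDeriv ℝ j (fun y => f y (g y)) x‖ ≤ 2 ^ s * (B * C) := by
  have hB0 : 0 ≤ B := (norm_nonneg _).trans (hB 0 (Nat.zero_le _))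
  have hC0 : 0 ≤ C := (norm_nonneg _).trans (hC 0 (Nat.zero_le _))
  have hj' : (j : WithTop ℕ∞) ≤ s := by exact_mod_cast hj
  calc ‖iteratedFDeriv ℝ j (fun y => f y (g y)) x‖
      ≤ ∑ i ∈ Finset.range (j + 1),
          (j.choose i : ℝ) * ‖iteratedFDeriv ℝ i f x‖ * ‖iteratedFDeriv ℝ (j - i) g x‖ :=
        norm_iteratedFDeriv_clm_apply_of_contDiffAt (hf.of_le hj') (hg.of_le hj')
    _ ≤ ∑ i ∈ Finset.range (j + 1), (j.choose i : ℝ) * (B * C) := by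
      refine Finset.sum_le_sum fun i hi => ?_
      rw [mul_assoc]
      gcongr
      · exact hB i ((Nat.lt_succ_iff.1 (Finset.mem_range.1 hi)).trans hj)
      · exact hC _ ((Nat.sub_le j i).trans hj)
    _ = 2 ^ j * (B * C) := by
      rw [← Finset.sum_mul]
      exact_mod_cast congrArg (fun k : ℕ => (k : ℝ) * (B * C)) (Nat.sum_range_choose j)
    _ ≤ 2 ^ s * (B * C) := by
      gcongr
      exact one_le_two

/-- The functions `g` and `h` are `C^s` at `x` and their derivatives of order at most `s` there
differ by at most `M`: a local form of the `C^s` distance. -/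
def JetClose (s : ℕ) (M : ℝ) (g h : E → F) (x : E) : Prop :=
  ContDiffAt ℝ s g x ∧ ContDiffAt ℝ s h x ∧
    ∀ j ≤ s, ‖iteratedFDeriv ℝ j g x - iteratedFDeriv ℝ j h x‖ ≤ M

theorem jetClose_iff_norm_iteratedFDeriv_sub_le {M : ℝ} {g h : E → F} (hg : ContDiffAt ℝ s g x)
    (hh : ContDiffAt ℝ s h x) :
    JetClose s M g h x ↔ ∀ j ≤ s, ‖iteratedFDeriv ℝ j (g - h) x‖ ≤ M := by
  simp only [JetClose, hg, hh, true_and]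
  refine forall₂_congr fun j hj => ?_
  have hj' : (j : WithTop ℕ∞) ≤ s := by exact_mod_cast hj
  rw [iteratedFDeriv_sub_apply (hg.of_le hj') (hh.of_le hj')]

namespace JetClose

variable {M M' : ℝ} {g h : E → F}

theorem nonneg (H : JetClose s M g h x) : 0 ≤ M :=
  (norm_nonneg _).trans (H.2.2 0 (Nat.zero_le s))

theorem mono (H : JetClose s M g h x) (hM : M ≤ M') : JetClose s M' g h x :=
  ⟨H.1, H.2.1, fun j hj => (H.2.2 j hj).trans hM⟩

theorem of_sub_eventuallyEq (H : JetClose s M g h x) {g' h' : E → F} (hg' : ContDiffAt ℝ s g' x)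
    (hh' : ContDiffAt ℝ s h' x) (he : g' - h' =ᶠ[𝓝 x] g - h) : JetClose s M g' h' x := by
  rw [jetClose_iff_norm_iteratedFDeriv_sub_le hg' hh']
  intro j hj
  rw [(he.iteratedFDeriv ℝ j).eq_of_nhds]
  exact (jetClose_iff_norm_iteratedFDeriv_sub_le H.1 H.2.1).1 H j hj

end JetClose

theorem exists_eventually_jetClose_clm_comp {φ : E → E'} {Q : E → F →L[ℝ] G}
    (hφ : ContDiffAt ℝ s φ x) (hQ : ContDiffAt ℝ s Q x) :
    ∃ C : ℝ, ∀ᶠ u in 𝓝 x, ∀ (g h : E' → F) (M : ℝ), JetClose s M g h (φ u) →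
      JetClose s (C * M) (fun v => Q v (g (φ v))) (fun v => Q v (h (φ v))) u := by
  obtain ⟨D, hD1, hD⟩ := exists_eventually_norm_iteratedFDeriv_le hφ
  obtain ⟨B, -, hB⟩ := exists_eventually_norm_iteratedFDeriv_le hQ
  have hs : (s : WithTop ℕ∞) ≠ ((⊤ : ℕ∞) : WithTop ℕ∞) := by
    exact_mod_cast ENat.natCast_ne_top s
  refine ⟨2 ^ s * (B * (s.factorial * D ^ s)), ?_⟩
  filter_upwards [hD, hB, hφ.eventually hs, hQ.eventually hs] with u hDu hBu hφu hQu g h M H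
  have hgφ := H.1.comp u hφu
  have hhφ := H.2.1.comp u hφu
  have hM := (jetClose_iff_norm_iteratedFDeriv_sub_le H.1 H.2.1).1 H
  have hsub := fun i hi =>
    norm_iteratedFDeriv_comp_le_of_forall_le (H.1.sub H.2.1) hφu hD1 hM hDu (j := i) hi
  refine (jetClose_iff_norm_iteratedFDeriv_sub_le (hQu.clm_apply hgφ) (hQu.clm_apply hhφ)).2
    fun j hj => ?_
  calc ‖iteratedFDeriv ℝ j ((fun v => Q v (g (φ v))) - fun v => Q v (h (φ v))) u‖
      = ‖iteratedFDeriv ℝ j (fun v => Q v (((g - h) ∘ φ) v)) u‖ := by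
        congr 2
        exact funext fun v => (map_sub (Q v) _ _).symm
    _ ≤ 2 ^ s * (B * (s.factorial * M * D ^ s)) :=
        norm_iteratedFDeriv_clm_apply_le_of_forall_le hQu (hgφ.sub hhφ) hBu hsub hj
    _ = 2 ^ s * (B * (s.factorial * D ^ s)) * M := by ring

theorem exists_forall_of_isCompact_of_eventually {X : Type*} [TopologicalSpace X] {K : Set X}
    (hK : IsCompact K) {p : ℝ → X → Prop} (hp : ∀ ⦃C C' x⦄, C ≤ C' → p C x → p C' x)
    (h : ∀ x ∈ K, ∃ C, ∀ᶠ u in 𝓝 x, p C u) : ∃ C, ∀ x ∈ K, p C x := by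
  choose! C hC using h
  obtain ⟨t, -, htK⟩ := hK.elim_nhds_subcover _ hC
  obtain ⟨B, hB⟩ := (t.image C).bddAbove
  refine ⟨B, fun u hu => ?_⟩
  obtain ⟨x, hx, hux⟩ := mem_iUnion₂.1 (htK hu)
  exact hp (hB (Finset.mem_image_of_mem C hx)) hux

theorem exists_jetClose_clm_apply_of_isCompact {Q : E → F →L[ℝ] G} {K : Set E}
    (hK : IsCompact K) (hQ : ∀ x ∈ K, ContDiffAt ℝ s Q x) :
    ∃ C : ℝ, ∀ u ∈ K, ∀ (g h : E → F) (M : ℝ), JetClose s M g h u →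
      JetClose s (C * M) (fun v => Q v (g v)) (fun v => Q v (h v)) u :=
  exists_forall_of_isCompact_of_eventually hK
    (fun _ _ _ hC H g h M hM => (H g h M hM).mono (mul_le_mul_of_nonneg_right hC hM.nonneg))
    fun x hx => exists_eventually_jetClose_clm_comp (φ := id) contDiffAt_id (hQ x hx)

end IteratedDerivatives

theorem coe_le_coe_add_one (r : ℕ∞) : (r : WithTop ℕ∞) ≤ ((r + 1 : ℕ∞) : WithTop ℕ∞) := by
  exact_mod_cast le_self_add

theorem coe_add_one_le_coe (r : ℕ∞) : (r : WithTop ℕ∞) + 1 ≤ ((r + 1 : ℕ∞) : WithTop ℕ∞) := by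
  exact_mod_cast le_rfl

namespace CompleteOrbifoldMap.Transitions

variable {n m : ℕ} {r : ℕ∞} {X Y : Type*} [TopologicalSpace X] [TopologicalSpace Y]
  {O : Orbifold n (r + 1) X} {P : Orbifold m (r + 1) Y} {f : CompleteOrbifoldMap O P} {w z x : X}

namespace Orbisection

variable {T : f.Transitions}

noncomputable instance : AddCommGroup (T.Orbisection r) :=
  (T.orbisectionEquiv le_add_self r).addCommGroup

noncomputable instance : Module ℝ (T.Orbisection r) :=
  (T.orbisectionEquiv le_add_self r).module ℝ

theorem repr_add (σ τ : T.Orbisection r) : (σ + τ).repr = σ.repr + τ.repr :=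
  congrArg Subtype.val ((T.orbisectionEquiv le_add_self r).apply_symm_apply
    (T.orbisectionEquiv le_add_self r σ + T.orbisectionEquiv le_add_self r τ))

theorem repr_smul (a : ℝ) (σ : T.Orbisection r) : (a • σ).repr = a • σ.repr :=
  congrArg Subtype.val ((T.orbisectionEquiv le_add_self r).apply_symm_apply
    (a • T.orbisectionEquiv le_add_self r σ))

end Orbisection

/-- The local representatives of all orbisections near `y` in the chart at `x` are obtained from
those near `y'` in the chart at `x'` by a `C^r` change of coordinates and of the bundle
coordinates. -/
def Transfer (T : f.Transitions) (x : X) (y : Eu n) (x' : X) (y' : Eu n) : Prop :=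
  ∃ (φ : Eu n → Eu n) (Q : Eu n → Eu m →L[ℝ] Eu m), ContDiffAt ℝ (r : WithTop ℕ∞) φ y ∧
    ContDiffAt ℝ (r : WithTop ℕ∞) Q y ∧ φ y = y' ∧
    ∀ᶠ u in 𝓝 y, ∀ σ : T.Orbisection r, σ.repr x u = Q u (σ.repr x' (φ u))

theorem Transfer.trans {T : f.Transitions} {x x' x'' : X} {y y' y'' : Eu n}
    (h : T.Transfer x y x' y') (h' : T.Transfer x' y' x'' y'') : T.Transfer x y x'' y'' := by
  obtain ⟨φ, Q, hφ, hQ, rfl, he⟩ := h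
  obtain ⟨φ', Q', hφ', hQ', rfl, he'⟩ := h'
  refine ⟨φ' ∘ φ, fun u => (Q u).comp (Q' (φ u)), hφ'.comp y hφ, hQ.clm_comp (hQ'.comp y hφ),
    rfl, ?_⟩
  filter_upwards [he, hφ.continuousAt.eventually he'] with u hu hu' σ
  rw [hu, hu']
  rfl

theorem transfer_act (T : f.Transitions) (γ : (O.chart x).Γ) {y : Eu n} (hy : y ∈ f.dom x) :
    T.Transfer x y x ((O.chart x).act γ y) := by
  have hγy := f.act_mem_dom γ hy
  have hact := ((O.chart x).contDiffAt_act γ (f.dom_subset x hy)).of_le (coe_le_coe_add_one r)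
  refine ⟨(O.chart x).act γ, fun u => fderiv ℝ ((P.chart (f.toFun x)).act (f.Θ x γ⁻¹))
    (f.lift x ((O.chart x).act γ u)), hact, ?_, rfl, ?_⟩
  · have h1 := ((P.chart (f.toFun x)).contDiffAt_act (f.Θ x γ⁻¹)
      (f.mapsTo_lift x hγy)).fderiv_right (coe_add_one_le_coe r)
    exact h1.comp y (((f.contDiffAt_lift hγy).of_le (coe_le_coe_add_one r)).comp y hact)
  · filter_upwards [f.dom_mem_nhds hy] with u hu σ
    rw [← σ.repr_act γ⁻¹ (f.act_mem_dom γ hu), (O.chart x).act_inv_act γ (f.dom_subset x hu)]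

theorem contDiffAt_fderiv_η_lift (T : f.Transitions) (hz : z ∈ f.base x) {y : Eu n}
    (hy : y ∈ f.dom z) (hyP : f.lift z y ∈ (P.ψ (f.toFun z) (f.toFun x)).source) :
    ContDiffAt ℝ (r : WithTop ℕ∞) (fun u => fderiv ℝ (T.η z x) (f.lift z u)) y :=
  ((T.contDiffAt_η hz hyP).fderiv_right (coe_add_one_le_coe r)).comp y
    ((f.contDiffAt_lift hy).of_le (coe_le_coe_add_one r))

theorem contDiffAt_fderiv_ηInv_lift (T : f.Transitions) (hz : z ∈ f.base x) {y : Eu n}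
    (hy : y ∈ f.dom z) (hyP : f.lift z y ∈ (P.ψ (f.toFun z) (f.toFun x)).source) :
    ContDiffAt ℝ (r : WithTop ℕ∞)
      (fun u => fderiv ℝ (T.ηInv z x) (T.η z x (f.lift z u))) y := by
  have h1 := (T.contDiffAt_η hz hyP).of_le (coe_le_coe_add_one r)
  have h2 := (T.contDiffAt_ηInv hz hyP).fderiv_right (coe_add_one_le_coe r)
  have h3 := (f.contDiffAt_lift hy).of_le (coe_le_coe_add_one r)
  exact h2.comp y (h1.comp y h3)

theorem transfer_of_center (T : f.Transitions) (hz : z ∈ f.base x) :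
    T.Transfer z (O.chart z).center x (O.ψ z x (O.chart z).center) := by
  have hsrc := O.center_mem_source z x (f.base_subset hz)
  have hc := f.center_mem_dom z
  have hP := f.lift_center_mem_source hz
  refine ⟨O.ψ z x, fun u => fderiv ℝ (T.ηInv z x) (T.η z x (f.lift z u)),
    (O.contDiffAt_ψ (f.base_subset hz) hsrc).of_le (coe_le_coe_add_one r),
    T.contDiffAt_fderiv_ηInv_lift hz hc hP, rfl, ?_⟩
  filter_upwards [eventually_repr_ψ le_add_self T r hz, f.continuousAt_lift hc
    ((P.ψ (f.toFun z) (f.toFun x)).open_source.mem_nhds hP)] with u hu huP σ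
  rw [hu σ, T.fderiv_ηInv_fderiv_η le_add_self hz huP]

theorem transfer_to_center (T : f.Transitions) (hz : z ∈ f.base x) :
    T.Transfer x (O.ψ z x (O.chart z).center) z (O.chart z).center := by
  have hsrc := O.center_mem_source z x (f.base_subset hz)
  have ht := (O.ψ z x).map_source hsrc
  have hinv := (O.ψ z x).left_inv hsrc
  have hc := f.center_mem_dom z
  have hP := f.lift_center_mem_source hz
  have hφ := (O.contDiffAt_ψ_symm (f.base_subset hz) ht).of_le (coe_le_coe_add_one r)
  refine ⟨(O.ψ z x).symm, fun u => fderiv ℝ (T.η z x) (f.lift z ((O.ψ z x).symm u)), hφ, ?_,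
    hinv, ?_⟩
  · have h := T.contDiffAt_fderiv_η_lift hz hc hP
    rw [← hinv] at h
    exact h.comp _ hφ
  · have h := (O.ψ z x).continuousAt_symm ht
    rw [ContinuousAt, hinv] at h
    filter_upwards [h.eventually (eventually_repr_ψ le_add_self T r hz),
      (O.ψ z x).open_target.mem_nhds ht] with u hu hut σ
    have := hu σ
    rwa [(O.ψ z x).right_inv hut] at this

theorem transfer_of_proj_eq (T : f.Transitions) {x x' : X} {y y' : Eu n} (hy : y ∈ f.dom x)
    (hy' : y' ∈ f.dom x') (h : (O.chart x).proj y = (O.chart x').proj y') :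
    T.Transfer x y x' y' := by
  obtain ⟨γ, hγ⟩ := f.exists_act_eq hy (f.ψ_center_mem_dom (f.proj_mem_base hy))
    (O.proj_ψ_center (f.base_subset (f.proj_mem_base hy))).symm
  obtain ⟨γ', rfl⟩ := f.exists_act_ψ_center_eq hy' h.symm
  have hw' : (O.chart x).proj y ∈ f.base x' := h ▸ f.proj_mem_base hy'
  have h1 := T.transfer_act γ hy
  rw [hγ] at h1
  exact ((h1.trans (T.transfer_to_center (f.proj_mem_base hy))).trans
    (T.transfer_of_center hw')).trans (T.transfer_act γ' (f.ψ_center_mem_dom hw'))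

end CompleteOrbifoldMap.Transitions

/-! ### Function spaces -/

section ClosedSubspaces

universe u

variable {V : Type u} {W : Type*} [AddCommGroup V] [Module ℝ V] [TopologicalSpace V]

theorem isFrechet_of_isClosedEmbedding [IsTopologicalAddGroup V] [AddCommGroup W] [Module ℝ W]
    [UniformSpace W] [IsUniformAddGroup W] [LocallyConvexSpace ℝ W]
    [TopologicalSpace.MetrizableSpace W] [CompleteSpace W] {L : V →ₗ[ℝ] W}
    (hL : IsClosedEmbedding L) : IsFrechet V := by
  refine ⟨hL.isInducing.locallyConvexSpace, hL.isEmbedding.metrizableSpace, ?_⟩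
  let := IsTopologicalAddGroup.rightUniformSpace V
  have : IsUniformAddGroup V := isUniformAddGroup_of_addCommGroup
  have h : IsUniformInducing L := AddMonoidHom.isUniformInducing_of_isInducing hL.isInducing
  exact (completeSpace_iff_isComplete_range h).2 hL.isClosed_range.isComplete

theorem isBanachable_of_isClosedEmbedding [NormedAddCommGroup W] [NormedSpace ℝ W]
    [CompleteSpace W] {L : V →ₗ[ℝ] W} (hL : IsClosedEmbedding L) : IsBanachable V := by
  have hinj := hL.injective
  have hrange := hL.isClosed_range.isComplete
  obtain rfl := hL.eq_induced
  let B : NormedAddCommGroup V := NormedAddCommGroup.induced V W L hinj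
  have hB : IsUniformInducing L := ⟨rfl⟩
  have hcomplete := (completeSpace_iff_isComplete_range hB).2 hrange
  exact ⟨V, B, NormedSpace.induced ℝ V W L, hcomplete,
    ⟨ContinuousLinearEquiv.refl ℝ V⟩⟩

end ClosedSubspaces

theorem secondCountableTopology_continuousMultilinearMap {E F : Type*} [NormedAddCommGroup E]
    [NormedSpace ℝ E] [FiniteDimensional ℝ E] [NormedAddCommGroup F] [NormedSpace ℝ F]
    [FiniteDimensional ℝ F] (j : ℕ) : SecondCountableTopology (E [×j]→L[ℝ] F) := by
  have : FiniteDimensional ℝ (E [×j]→L[ℝ] F) :=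
    Module.Finite.of_injective (ContinuousMultilinearMap.toMultilinearMapLinear (R' := ℝ) (A := ℝ))
      ContinuousMultilinearMap.toMultilinearMap_injective
  have := FiniteDimensional.proper ℝ (E [×j]→L[ℝ] F)
  infer_instance

section CrSpace

variable {n : ℕ} {r : ℕ∞} {K : Set (Eu n)} {F : Type*} [NormedAddCommGroup F] [NormedSpace ℝ F]

open Classical in
/-- The formal power series at the points of `K` whose coefficients are given by a family `J` of
maps on `K`, as for an element of `C^r(K, F)`. The coefficients of order `> r`, and all of them
outside `K`, are put to be `0`. -/
noncomputable def jetSeries (J : ∀ j : {j : ℕ // (j : ℕ∞) ≤ r}, C(K, Eu n [×(j : ℕ)]→L[ℝ] F))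
    (y : Eu n) : FormalMultilinearSeries ℝ (Eu n) F :=
  fun j => if h : (j : ℕ∞) ≤ r ∧ y ∈ K then J ⟨j, h.1⟩ ⟨y, h.2⟩ else 0

variable {J : ∀ j : {j : ℕ // (j : ℕ∞) ≤ r}, C(K, Eu n [×(j : ℕ)]→L[ℝ] F)} {j : ℕ} {y : Eu n}

theorem jetSeries_apply (hj : (j : ℕ∞) ≤ r) (hy : y ∈ K) : jetSeries J y j = J ⟨j, hj⟩ ⟨y, hy⟩ :=
  dif_pos ⟨hj, hy⟩

theorem continuousOn_jetSeries (hj : (j : ℕ∞) ≤ r) :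
    ContinuousOn (fun y => jetSeries J y j) K := by
  rw [continuousOn_iff_continuous_domRestrict]
  exact (J ⟨j, hj⟩).continuous.congr fun y => (jetSeries_apply hj y.2).symm

theorem coe_le_of_coe_add_one_le (hj : ((j + 1 : ℕ) : ℕ∞) ≤ r) : (j : ℕ∞) ≤ r :=
  le_trans (by exact_mod_cast Nat.le_succ j) hj

theorem hasFDerivAt_jetSeries_of_mem_crSpace (hJ : J ∈ CrSpace r K F)
    (hj : ((j + 1 : ℕ) : ℕ∞) ≤ r) (hy : y ∈ interior K) :
    HasFDerivAt (fun u => jetSeries J u j) (jetSeries J y (j + 1)).curryLeft y := by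
  obtain ⟨g, hg, hgJ⟩ := hJ
  have hj' := coe_le_of_coe_add_one_le hj
  have hJg : (fun u => jetSeries J u j) =ᶠ[𝓝 y] iteratedFDeriv ℝ j g := by
    filter_upwards [isOpen_interior.mem_nhds hy] with u hu
    exact (jetSeries_apply hj' (interior_subset hu)).trans
      (hgJ ⟨j, hj'⟩ ⟨u, interior_subset hu⟩ hu)
  have hdiff : DifferentiableAt ℝ (iteratedFDeriv ℝ j g) y :=
    (hg.contDiffAt (isOpen_interior.mem_nhds hy)).differentiableAt_iteratedFDeriv
      (by exact_mod_cast (Nat.cast_lt.2 j.lt_succ_self).trans_le hj)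
  have hderiv : (jetSeries J y (j + 1)).curryLeft = fderiv ℝ (iteratedFDeriv ℝ j g) y := by
    rw [jetSeries_apply hj (interior_subset hy),
      hgJ ⟨j + 1, hj⟩ ⟨y, interior_subset hy⟩ hy]
    rfl
  rw [hderiv]
  exact hdiff.hasFDerivAt.congr_of_eventuallyEq hJg

theorem mem_crSpace_of_hasFDerivAt_jetSeries
    (hJ : ∀ j : ℕ, ((j + 1 : ℕ) : ℕ∞) ≤ r → ∀ y ∈ interior K,
      HasFDerivAt (fun u => jetSeries J u j) (jetSeries J y (j + 1)).curryLeft y) :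
    J ∈ CrSpace r K F := by
  have hT : HasFTaylorSeriesUpToOn (r : WithTop ℕ∞) (fun y => (jetSeries J y 0).curry0)
      (jetSeries J) (interior K) := by
    refine ⟨fun _ _ => rfl, fun j hj y hy => (hJ j ?_ y hy).hasFDerivWithinAt, fun j hj =>
      (continuousOn_jetSeries (by exact_mod_cast hj)).mono interior_subset⟩
    exact_mod_cast Order.add_one_le_of_lt (show (j : ℕ∞) < r by exact_mod_cast hj)
  refine ⟨_, hT.contDiffOn, fun j y hy => ?_⟩
  rw [← iteratedFDerivWithin_of_isOpen _ isOpen_interior hy,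
    ← hT.eq_iteratedFDerivWithin_of_uniqueDiffOn (by exact_mod_cast j.2)
      isOpen_interior.uniqueDiffOn hy, jetSeries_apply j.2 y.2]

theorem tendstoUniformlyOn_jetSeries [CompactSpace K] {ι : Type*} {l : Filter ι}
    {A : ι → ∀ j : {j : ℕ // (j : ℕ∞) ≤ r}, C(K, Eu n [×(j : ℕ)]→L[ℝ] F)}
    (hA : Tendsto A l (𝓝 J)) (hj : (j : ℕ∞) ≤ r) :
    TendstoUniformlyOn (fun i y => jetSeries (A i) y j) (fun y => jetSeries J y j) l K := by
  have hAj := ContinuousMap.tendsto_iff_tendstoUniformly.1 (tendsto_pi_nhds.1 hA ⟨j, hj⟩)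
  rw [tendstoUniformlyOn_iff_tendstoUniformly_comp_coe]
  simpa only [Function.comp_def, jetSeries_apply hj (Subtype.coe_prop _)] using hAj

theorem isClosed_crSpace (r : ℕ∞) (hK : IsCompact K) (F : Type*) [NormedAddCommGroup F]
    [NormedSpace ℝ F] :
    IsClosed (CrSpace r K F : Set (∀ j : {j : ℕ // (j : ℕ∞) ≤ r},
      C(K, Eu n [×(j : ℕ)]→L[ℝ] F))) := by
  have : CompactSpace K := isCompact_iff_compactSpace.1 hK
  refine isClosed_of_closure_subset fun J hJ => mem_crSpace_of_hasFDerivAt_jetSeries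
    fun j hj y hy => ?_
  have := mem_closure_iff_comap_neBot.1 hJ
  have hunif {i : ℕ} (hi : (i : ℕ∞) ≤ r) :=
    (tendstoUniformlyOn_jetSeries (A := ((↑) : CrSpace r K F → _)) (l := comap _ (𝓝 J))
      tendsto_comap hi).mono interior_subset
  have hcurry := (continuousMultilinearCurryLeftEquiv ℝ (fun _ : Fin (j + 1) => Eu n)
    F).isometry.uniformContinuous
  exact hasFDerivAt_of_tendstoUniformlyOn isOpen_interior
    (hcurry.comp_tendstoUniformlyOn (hunif hj))
    (fun A u hu => hasFDerivAt_jetSeries_of_mem_crSpace A.2 hj hu)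
    (fun u hu => (hunif (coe_le_of_coe_add_one_le hj)).tendsto_at hu) hy

end CrSpace

/-! ### The topology of the space of orbisections -/

theorem natCast_le_coe {r : ℕ∞} {s : ℕ} (hs : (s : ℕ∞) ≤ r) :
    (s : WithTop ℕ∞) ≤ (r : WithTop ℕ∞) := by
  exact_mod_cast hs

namespace CompleteOrbifoldMap.Transitions

variable {n m : ℕ} {r : ℕ∞} {X Y : Type*} [TopologicalSpace X] [TopologicalSpace Y]
  {O : Orbifold n (r + 1) X} {P : Orbifold m (r + 1) Y} {f : CompleteOrbifoldMap O P}
  {T : f.Transitions} {x z : X} {s : ℕ}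

theorem changeDom_subset_dom : T.changeDom z x ⊆ f.dom z := fun _ hy =>
  hy.2.2.2.self_of_nhds.1

theorem changeDom_self_mem_nhds (T : f.Transitions) (x : X) :
    T.changeDom x x ∈ 𝓝 (O.chart x).center := by
  obtain ⟨δ, hδ⟩ := T.exists_bundleψ_self_eq x
  have hx := f.mem_base_self x
  have hc := f.center_mem_dom x
  filter_upwards [hδ.eventually_nhds, f.dom_mem_nhds hc,
    (O.ψ x x).open_source.mem_nhds (O.center_mem_source x x (f.base_subset hx)),
    f.continuousAt_lift hc ((P.ψ (f.toFun x) (f.toFun x)).open_source.mem_nhds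
      (f.lift_center_mem_source hx))] with y hy hyd hys hyP
  refine ⟨hys, hyP, hx, ?_⟩
  filter_upwards [hy, f.dom_mem_nhds hyd] with u hu hud
  have hact : O.ψ x x u = (O.chart x).act δ u := congrArg Prod.fst (hu 0)
  refine ⟨hud, hact ▸ f.act_mem_dom δ hud, fun v => ?_⟩
  rw [← T.toTotal_bundleAct δ (q := (u, v)) hud (f.act_mem_dom δ hud)]
  congr 1
  exact (hu v).symm

theorem contDiffAt_bundleψ_comp {l : Eu n → Eu n × Eu m} {y : Eu n}
    (hl : ContDiffAt ℝ (r : WithTop ℕ∞) l y) (hy : (l y).1 ∈ T.changeDom z x) :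
    ContDiffAt ℝ (r : WithTop ℕ∞) (fun u => T.bundleψ z x (l u)) y := by
  have hz := hy.2.2.1
  refine ContDiffAt.prodMk ?_ ?_
  · exact ContDiffAt.comp (g := O.ψ z x) (f := fun u => (l u).1) y
      ((O.contDiffAt_ψ (f.base_subset hz) hy.1).of_le (coe_le_coe_add_one r)) hl.fst
  · exact (ContDiffAt.comp (g := fun u => fderiv ℝ (T.η z x) (f.lift z u))
      (f := fun u => (l u).1) y
      (T.contDiffAt_fderiv_η_lift hz (changeDom_subset_dom hy) hy.2.1) hl.fst).clm_apply hl.snd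

/-- The lift of an orbifold map over the chart at `x`, read in the chart of `f^*(TP)` over `z`;
the neighbourhoods of the `C^r` topology are given by its derivatives. -/
noncomputable def MapRep.liftIn (g : T.MapRep r) (x z : X) (u : Eu n) : Eu n × Eu m :=
  T.bundleψ (T.bundleProj (g.toFun x)) z (g.lift x u)

theorem MapRep.contDiffAt_liftIn (g : T.MapRep r) {y : Eu n} (hy : y ∈ g.dom x)
    (h : (g.lift x y).1 ∈ T.changeDom (T.bundleProj (g.toFun x)) z) :
    ContDiffAt ℝ (r : WithTop ℕ∞) (g.liftIn x z) y :=
  contDiffAt_bundleψ_comp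
    ((g.contDiffOn_lift x).contDiffAt ((g.isSubchart_dom x).isOpen.mem_nhds hy)) h

namespace Orbisection

/-- The lift `u ↦ (u, repr x u)` of an orbisection over the chart at `x`, read in the chart of
`f^*(TP)` over `z`. -/
noncomputable def liftIn (σ : T.Orbisection r) (x z : X) (u : Eu n) : Eu n × Eu m :=
  T.bundleψ x z (u, σ.repr x u)

theorem liftIn_toMapRep (σ : T.Orbisection r) :
    (Orbisection.toMapRep T σ).liftIn x z = σ.liftIn x z := by
  funext u
  change T.bundleψ (T.bundleProj (σ.toFun x)) z (u, σ.repr x u) = _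
  rw [σ.bundleProj_toFun, liftIn]

theorem contDiffAt_repr (σ : T.Orbisection r) {y : Eu n} (hy : y ∈ f.dom x) :
    ContDiffAt ℝ (r : WithTop ℕ∞) (σ.repr x) y :=
  (σ.contDiffOn_repr x).contDiffAt (f.dom_mem_nhds hy)

theorem contDiffAt_liftIn (σ : T.Orbisection r) {y : Eu n} (hy : y ∈ T.changeDom x z) :
    ContDiffAt ℝ (r : WithTop ℕ∞) (σ.liftIn x z) y :=
  contDiffAt_bundleψ_comp (l := fun u => (u, σ.repr x u))
    (contDiffAt_id.prodMk (σ.contDiffAt_repr (changeDom_subset_dom hy))) hy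

theorem liftIn_sub_liftIn (σ τ : T.Orbisection r) (u : Eu n) :
    σ.liftIn x z u - τ.liftIn x z u =
      (0, fderiv ℝ (T.η x z) (f.lift x u) (σ.repr x u - τ.repr x u)) := by
  ext1
  · exact sub_self _
  · exact (map_sub _ _ _).symm

theorem eq_repr_of_lift (hr : 1 ≤ r) (σ : T.Orbisection r) {D : Set (Eu n)}
    (hD : (O.chart x).IsSubchart D) {l : Eu n → Eu n × Eu m} (hz : z = x)
    (hmaps : ∀ y ∈ D, (l y).1 ∈ f.dom z) (hl : ContDiffOn ℝ (r : WithTop ℕ∞) l D)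
    (htot : ∀ y, ∀ hy : y ∈ D, T.toTotal z (l y) (hmaps y hy) = σ.toFun ((O.chart x).proj y))
    (hgerm : ∀ᶠ y in 𝓝 (O.chart x).center, l y = (y, σ.repr x y)) :
    ∀ y ∈ D, l y = (y, σ.repr x y) := by
  subst hz
  have hk : (1 : ℕ∞) ≤ r + 1 := le_add_self
  have hid : ∀ y ∈ D, (l y).1 = y := by
    apply (O.chart z).eq_self_of_proj_eq hk hD.isOpen hD.isConnected.isPreconnected hD.subset_dom
      (contDiff_fst.comp_contDiffOn (hl.of_le (by exact_mod_cast hr)))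
      (fun y hy => f.dom_subset z (hmaps y hy)) _ hD.center_mem
    · filter_upwards [hgerm] with u hu
      rw [Function.comp_apply, hu]
    · intro y hy
      have h := congrArg T.bundleProj (htot y hy)
      rwa [σ.bundleProj_toFun] at h
  intro y hy
  have hsnd : (l y).2 = σ.repr z y := by
    apply σ.eq_repr_of_toTotal_eq hk (hid y hy ▸ hmaps y hy)
    rw [← htot y hy]
    congr 1
    exact Prod.ext (hid y hy).symm rfl
  exact Prod.ext (hid y hy) hsnd

theorem toOrbMap_mem_mapNhd_iff (hr : 1 ≤ r) (σ : T.Orbisection r) (g₀ : T.MapRep r)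
    (x z : X) (K : Set (Eu n)) (s : ℕ) (ε : ℝ) :
    Orbisection.toOrbMap T σ ∈ T.mapNhd g₀ x z K s ε ↔ K ⊆ T.changeDom x z ∧
      ∀ j ≤ s, ∀ y ∈ K,
        ‖iteratedFDeriv ℝ j (σ.liftIn x z) y - iteratedFDeriv ℝ j (g₀.liftIn x z) y‖ < ε := by
  constructor
  · rintro ⟨g, hg, hKg, hch, hbd⟩
    obtain ⟨hfun, hgerm⟩ : g.toFun = σ.toFun ∧
      ∀ x, g.lift x =ᶠ[𝓝 (O.chart x).center] fun y => (y, σ.repr x y) := Quotient.exact hg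
    have hx : T.bundleProj (g.toFun x) = x := by rw [hfun, σ.bundleProj_toFun]
    have hlift := σ.eq_repr_of_lift hr (g.isSubchart_dom x) hx (g.mapsTo_lift x)
      (g.contDiffOn_lift x) (fun y hy => (g.toTotal_lift x y hy).trans (by rw [hfun])) (hgerm x)
    rw [hx] at hch hbd
    refine ⟨fun y hy => ?_, fun j hj y hy => ?_⟩
    · simpa only [hlift y (hKg hy)] using hch y hy
    · have he : (fun u => T.bundleψ x z (g.lift x u)) =ᶠ[𝓝 y] σ.liftIn x z := by
        filter_upwards [(g.isSubchart_dom x).isOpen.mem_nhds (hKg hy)] with u hu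
        rw [hlift u hu, liftIn]
      rw [← (he.iteratedFDeriv ℝ j).eq_of_nhds]
      exact hbd j hj y hy
  · rintro ⟨hch, hbd⟩
    rw [← σ.liftIn_toMapRep] at hbd
    refine ⟨Orbisection.toMapRep T σ, rfl, hch.trans changeDom_subset_dom, fun y hy => ?_, hbd⟩
    change y ∈ T.changeDom (T.bundleProj (σ.toFun x)) z
    rw [σ.bundleProj_toFun]
    exact hch hy

theorem exists_jetClose_liftIn {A : Set (Eu n)} (hA : IsCompact A) (hch : A ⊆ T.changeDom x z)
    (hs : (s : ℕ∞) ≤ r) :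
    ∃ C : ℝ, ∀ y ∈ A, ∀ (σ τ : T.Orbisection r) (M : ℝ),
      JetClose s M (σ.repr x) (τ.repr x) y →
      JetClose s (C * M) (σ.liftIn x z) (τ.liftIn x z) y := by
  have hs' := natCast_le_coe hs
  let Q : Eu n → Eu m →L[ℝ] (Eu n × Eu m) := fun u =>
    (ContinuousLinearMap.inr ℝ (Eu n) (Eu m)).comp (fderiv ℝ (T.η x z) (f.lift x u))
  have hQ : ∀ y ∈ A, ContDiffAt ℝ s Q y := fun y hy =>
    (contDiffAt_const.clm_comp (T.contDiffAt_fderiv_η_lift (hch hy).2.2.1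
      (changeDom_subset_dom (hch hy)) (hch hy).2.1)).of_le hs'
  obtain ⟨C, hC⟩ := exists_jetClose_clm_apply_of_isCompact hA hQ
  refine ⟨C, fun y hy σ τ M H => (hC y hy _ _ M H).of_sub_eventuallyEq
    ((σ.contDiffAt_liftIn (hch hy)).of_le hs') ((τ.contDiffAt_liftIn (hch hy)).of_le hs')
    (Eventually.of_forall fun u => ?_)⟩
  rw [Pi.sub_apply, liftIn_sub_liftIn, Pi.sub_apply, ← map_sub]
  rfl

theorem exists_jetClose_repr_of_liftIn {A : Set (Eu n)} (hA : IsCompact A)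
    (hch : A ⊆ T.changeDom x z) (hs : (s : ℕ∞) ≤ r) :
    ∃ C : ℝ, ∀ y ∈ A, ∀ (σ τ : T.Orbisection r) (M : ℝ),
      JetClose s M (σ.liftIn x z) (τ.liftIn x z) y →
      JetClose s (C * M) (σ.repr x) (τ.repr x) y := by
  have hs' := natCast_le_coe hs
  let Q : Eu n → (Eu n × Eu m) →L[ℝ] Eu m := fun u =>
    (fderiv ℝ (T.ηInv x z) (T.η x z (f.lift x u))).comp (ContinuousLinearMap.snd ℝ (Eu n) (Eu m))
  have hQ : ∀ y ∈ A, ContDiffAt ℝ s Q y := fun y hy =>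
    ((T.contDiffAt_fderiv_ηInv_lift (hch hy).2.2.1 (changeDom_subset_dom (hch hy))
      (hch hy).2.1).clm_comp contDiffAt_const).of_le hs'
  obtain ⟨C, hC⟩ := exists_jetClose_clm_apply_of_isCompact hA hQ
  refine ⟨C, fun y hy σ τ M H => (hC y hy _ _ M H).of_sub_eventuallyEq
    ((σ.contDiffAt_repr (changeDom_subset_dom (hch hy))).of_le hs')
    ((τ.contDiffAt_repr (changeDom_subset_dom (hch hy))).of_le hs') ?_⟩
  filter_upwards [f.continuousAt_lift (changeDom_subset_dom (hch hy))
    ((P.ψ (f.toFun x) (f.toFun z)).open_source.mem_nhds (hch hy).2.1)] with u hu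
  rw [Pi.sub_apply, Pi.sub_apply, ← map_sub, liftIn_sub_liftIn]
  exact (T.fderiv_ηInv_fderiv_η le_add_self (hch hy).2.2.1 hu _).symm

theorem eventually_jetClose_liftIn (hr : 1 ≤ r) {A : Set (Eu n)} (hA : IsCompact A)
    (hch : A ⊆ T.changeDom x z) (hs : (s : ℕ∞) ≤ r) (σ : T.Orbisection r) {ε : ℝ} (hε : 0 < ε) :
    ∀ᶠ τ in 𝓝 σ, ∀ y ∈ A, JetClose s ε (τ.liftIn x z) (σ.liftIn x z) y := by
  let N := T.mapNhd (Orbisection.toMapRep T σ) x z A s ε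
  have hN : IsOpen N := by
    refine TopologicalSpace.isOpen_generateFrom_of_mem ⟨Orbisection.toMapRep T σ, x, z, A, s, ε,
      hA, hch.trans changeDom_subset_dom, fun y hy => ?_, hs, hε, rfl⟩
    change y ∈ T.changeDom (T.bundleProj (σ.toFun x)) z
    rw [σ.bundleProj_toFun]
    exact hch hy
  have hσ : Orbisection.toOrbMap T σ ∈ N := by
    refine (σ.toOrbMap_mem_mapNhd_iff hr _ x z A s ε).2 ⟨hch, fun j _ y _ => ?_⟩
    rwa [liftIn_toMapRep, sub_self, norm_zero]
  filter_upwards [(isOpen_induced hN).mem_nhds hσ] with τ hτ y hy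
  obtain ⟨-, hbd⟩ := (τ.toOrbMap_mem_mapNhd_iff hr _ x z A s ε).1 hτ
  rw [liftIn_toMapRep] at hbd
  exact ⟨(τ.contDiffAt_liftIn (hch hy)).of_le (natCast_le_coe hs),
    (σ.contDiffAt_liftIn (hch hy)).of_le (natCast_le_coe hs), fun j hj => (hbd j hj y hy).le⟩

theorem eventually_jetClose_repr (hr : 1 ≤ r) {A : Set (Eu n)} (hA : IsCompact A)
    (hch : A ⊆ T.changeDom x z) (hs : (s : ℕ∞) ≤ r) (σ : T.Orbisection r) {ε : ℝ} (hε : 0 < ε) :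
    ∀ᶠ τ in 𝓝 σ, ∀ y ∈ A, JetClose s ε (τ.repr x) (σ.repr x) y := by
  obtain ⟨C, hC⟩ := exists_jetClose_repr_of_liftIn hA hch hs
  obtain ⟨δ, hδ, hCδ⟩ := exists_pos_mul_lt hε C
  filter_upwards [eventually_jetClose_liftIn hr hA hch hs σ hδ] with τ hτ y hy
  exact (hC y hy τ σ δ (hτ y hy)).mono hCδ.le

/-- The `j`-th derivatives of the local representatives in the chart at `x`, restricted to `K`. -/
noncomputable def derivOn {K : Set (Eu n)} (hK : K ⊆ f.dom x) (j : {j : ℕ // (j : ℕ∞) ≤ r}) :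
    T.Orbisection r →ₗ[ℝ] C(K, Eu n [×(j : ℕ)]→L[ℝ] Eu m) where
  toFun σ :=
    { toFun := fun y => iteratedFDeriv ℝ (j : ℕ) (σ.repr x) y
      continuous_toFun := continuous_iff_continuousAt.2 fun y =>
        ((σ.contDiffAt_repr (hK y.2)).continuousAt_iteratedFDeriv (natCast_le_coe j.2)).comp
          continuous_subtype_val.continuousAt }
  map_add' σ τ := by
    ext1 y
    have hj := natCast_le_coe j.2
    change iteratedFDeriv ℝ (j : ℕ) ((σ + τ).repr x) y = _
    rw [repr_add]
    exact iteratedFDeriv_add_apply ((σ.contDiffAt_repr (hK y.2)).of_le hj)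
      ((τ.contDiffAt_repr (hK y.2)).of_le hj)
  map_smul' a σ := by
    ext1 y
    change iteratedFDeriv ℝ (j : ℕ) ((a • σ).repr x) y = _
    rw [repr_smul, Pi.smul_apply, iteratedFDeriv_const_smul_apply
      ((σ.contDiffAt_repr (hK y.2)).of_le (natCast_le_coe j.2))]
    rfl

theorem continuous_derivOn (hr : 1 ≤ r) {K : Set (Eu n)} (hKc : IsCompact K)
    (hch : K ⊆ T.changeDom x z) (j : {j : ℕ // (j : ℕ∞) ≤ r}) :
    Continuous (derivOn (T := T) (hch.trans changeDom_subset_dom) j) := by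
  have : CompactSpace K := isCompact_iff_compactSpace.1 hKc
  refine continuous_iff_continuousAt.2 fun σ =>
    (Metric.nhds_basis_closedBall (α := C(K, Eu n [×(j : ℕ)]→L[ℝ] Eu m))).tendsto_right_iff.2
      fun ε hε => ?_
  filter_upwards [eventually_jetClose_repr hr hKc hch j.2 σ hε] with τ hτ
  refine (ContinuousMap.dist_le hε.le).2 fun y => ?_
  rw [dist_eq_norm]
  exact (hτ y y.2).2.2 j le_rfl

theorem eventually_mem_mapNhd (hr : 1 ≤ r) {l : Filter (T.Orbisection r)} {σ : T.Orbisection r}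
    {g₀ : T.MapRep r} {A : Set (Eu n)} {ε : ℝ} (hA : IsCompact A) (hAg₀ : A ⊆ g₀.dom x)
    (hg₀ : ∀ y ∈ A, (g₀.lift x y).1 ∈ T.changeDom (T.bundleProj (g₀.toFun x)) z)
    (hs : (s : ℕ∞) ≤ r) (hσ : Orbisection.toOrbMap T σ ∈ T.mapNhd g₀ x z A s ε)
    (hl : ∀ M > 0, ∀ᶠ τ in l, ∀ y ∈ A, JetClose s M (τ.repr x) (σ.repr x) y) :
    ∀ᶠ τ in l, Orbisection.toOrbMap T τ ∈ T.mapNhd g₀ x z A s ε := by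
  obtain ⟨hch, hbd⟩ := (σ.toOrbMap_mem_mapNhd_iff hr g₀ x z A s ε).1 hσ
  have hgap : ∀ᶠ ρ in 𝓝 (0 : ℝ), ∀ y ∈ A, ∀ j : Fin (s + 1),
      ρ + ‖iteratedFDeriv ℝ j (σ.liftIn x z) y - iteratedFDeriv ℝ j (g₀.liftIn x z) y‖ < ε := by
    refine hA.eventually_forall_of_forall_eventually fun y hy => eventually_all.2 fun j => ?_
    have hj : (j : ℕ) ≤ s := Nat.lt_succ_iff.1 j.2
    have hjr := natCast_le_coe ((Nat.cast_le.2 hj).trans hs)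
    have hc := ((σ.contDiffAt_liftIn (hch hy)).continuousAt_iteratedFDeriv hjr).sub
      ((g₀.contDiffAt_liftIn (hAg₀ hy) (hg₀ y hy)).continuousAt_iteratedFDeriv hjr)
    refine (continuousAt_fst.add (ContinuousAt.comp (x := ((0 : ℝ), y)) hc.norm
      continuousAt_snd)).eventually_lt continuousAt_const ?_
    simpa using hbd j hj y hy
  obtain ⟨ρ, hρ, hgap⟩ := hgap.exists_gt
  obtain ⟨C, hC⟩ := exists_jetClose_liftIn hA hch hs
  obtain ⟨M, hM, hCM⟩ := exists_pos_mul_lt hρ C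
  filter_upwards [hl M hM] with τ hτ
  refine (τ.toOrbMap_mem_mapNhd_iff hr g₀ x z A s ε).2 ⟨hch, fun j hj y hy => ?_⟩
  calc _ ≤ _ := norm_sub_le_norm_sub_add_norm_sub _ (iteratedFDeriv ℝ j (σ.liftIn x z) y) _
    _ ≤ ρ + _ := by
      gcongr
      exact ((hC y hy τ σ M (hτ y hy)).2.2 j hj).trans hCM.le
    _ < ε := hgap y hy ⟨j, Nat.lt_succ_of_le hj⟩

section Cover

variable {ι : Type*} {c : ι → X} {K : ι → Set (Eu n)}

/-- The derivatives of all orders at most `r` of the local representatives, on a family of subsets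
of charts. -/
noncomputable def jets (hK : ∀ i, K i ⊆ f.dom (c i)) : T.Orbisection r →ₗ[ℝ]
    ∀ (i : ι) (j : {j : ℕ // (j : ℕ∞) ≤ r}), C(K i, Eu n [×(j : ℕ)]→L[ℝ] Eu m) :=
  LinearMap.pi fun i => LinearMap.pi fun j => derivOn (hK i) j

/-- Near a point of the chart at `x` all orbisections are determined through a single transfer by
their representatives on one member of the cover; compactness makes the constant uniform. -/
theorem exists_jetClose_repr_of_cover (hK : ∀ i, K i ⊆ f.dom (c i))
    (hcov : ∀ w, ∃ i, ∃ y ∈ interior (K i), (O.chart (c i)).proj y = w) {A : Set (Eu n)}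
    (hA : IsCompact A) (hAd : A ⊆ f.dom x) (hs : (s : ℕ∞) ≤ r) :
    ∃ C : ℝ, ∀ y ∈ A, ∀ (σ τ : T.Orbisection r) (M : ℝ),
      (∀ i, ∀ u ∈ K i, JetClose s M (σ.repr (c i)) (τ.repr (c i)) u) →
      JetClose s (C * M) (σ.repr x) (τ.repr x) y := by
  have hs' := natCast_le_coe hs
  refine exists_forall_of_isCompact_of_eventually hA (fun C C' y hC H σ τ M hM => ?_)
    fun y hy => ?_
  · obtain ⟨i, u, hu, -⟩ := hcov x
    exact (H σ τ M hM).mono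
      (mul_le_mul_of_nonneg_right hC (hM i u (interior_subset hu)).nonneg)
  obtain ⟨i, y', hy', hproj⟩ := hcov ((O.chart x).proj y)
  obtain ⟨φ, Q, hφ, hQ, rfl, he⟩ := T.transfer_of_proj_eq (hAd hy) (hK i (interior_subset hy'))
    hproj.symm
  obtain ⟨C, hC⟩ := exists_eventually_jetClose_clm_comp (hφ.of_le hs') (hQ.of_le hs')
  refine ⟨C, ?_⟩
  filter_upwards [hC, hφ.continuousAt.eventually (isOpen_interior.mem_nhds hy'),
    he.eventually_nhds, f.dom_mem_nhds (hAd hy)] with u hu hφu heu hud σ τ M hM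
  refine (hu _ _ M (hM i _ (interior_subset hφu))).of_sub_eventuallyEq
    ((σ.contDiffAt_repr hud).of_le hs') ((τ.contDiffAt_repr hud).of_le hs') ?_
  filter_upwards [heu] with v hv
  rw [Pi.sub_apply, hv σ, hv τ]
  rfl

theorem jets_injective (hK : ∀ i, K i ⊆ f.dom (c i))
    (hcov : ∀ w, ∃ i, ∃ y ∈ interior (K i), (O.chart (c i)).proj y = w) :
    Function.Injective (jets (T := T) hK) := by
  intro σ τ h
  refine Orbisection.repr_injective (funext fun x => funext fun y => ?_)
  by_cases hy : y ∈ f.dom x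
  · have h0 : (((0 : ℕ) : ℕ∞)) ≤ r := zero_le
    obtain ⟨C, hC⟩ := exists_jetClose_repr_of_cover (T := T) hK hcov isCompact_singleton
      (singleton_subset_iff.2 hy) h0
    have hclose := hC y rfl σ τ 0 fun i u hu => by
      refine ⟨(σ.contDiffAt_repr (hK i hu)).of_le (natCast_le_coe h0),
        (τ.contDiffAt_repr (hK i hu)).of_le (natCast_le_coe h0), fun j hj => ?_⟩
      obtain rfl := Nat.le_zero.1 hj
      have hu' : iteratedFDeriv ℝ 0 (σ.repr (c i)) u = iteratedFDeriv ℝ 0 (τ.repr (c i)) u :=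
        DFunLike.congr_fun (congrFun (congrFun h i) ⟨0, h0⟩) (⟨u, hu⟩ : K i)
      rw [hu', sub_self, norm_zero]
    have heq := hclose.2.2 0 le_rfl
    rw [mul_zero, norm_le_zero_iff, sub_eq_zero] at heq
    simpa using DFunLike.congr_fun heq 0
  · rw [σ.repr_eq_zero x y hy, τ.repr_eq_zero x y hy]

theorem eventually_jetClose_of_tendsto_jets [Finite ι] (hKc : ∀ i, IsCompact (K i))
    (hK : ∀ i, K i ⊆ f.dom (c i)) {l : Filter (T.Orbisection r)} {σ : T.Orbisection r}
    (hl : Tendsto (jets hK) l (𝓝 (jets hK σ))) (hs : (s : ℕ∞) ≤ r) {M : ℝ} (hM : 0 < M) :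
    ∀ᶠ τ in l, ∀ i, ∀ y ∈ K i, JetClose s M (τ.repr (c i)) (σ.repr (c i)) y := by
  have : ∀ i, CompactSpace (K i) := fun i => isCompact_iff_compactSpace.1 (hKc i)
  have hjr (j : Fin (s + 1)) : ((j : ℕ) : ℕ∞) ≤ r :=
    (Nat.cast_le.2 (Nat.lt_succ_iff.1 j.2)).trans hs
  have hdist : ∀ᶠ τ in l, ∀ (i : ι) (j : Fin (s + 1)),
      dist (jets hK τ i ⟨j, hjr j⟩) (jets hK σ i ⟨j, hjr j⟩) ≤ M :=
    eventually_all.2 fun i => eventually_all.2 fun j =>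
      Metric.nhds_basis_closedBall.tendsto_right_iff.1
        (tendsto_pi_nhds.1 (tendsto_pi_nhds.1 hl i) ⟨j, hjr j⟩) M hM
  filter_upwards [hdist] with τ hτ i y hy
  refine ⟨(τ.contDiffAt_repr (hK i hy)).of_le (natCast_le_coe hs),
    (σ.contDiffAt_repr (hK i hy)).of_le (natCast_le_coe hs), fun j hj => ?_⟩
  rw [← dist_eq_norm]
  exact (ContinuousMap.dist_le hM.le).1 (hτ i ⟨j, Nat.lt_succ_of_le hj⟩) ⟨y, hy⟩

theorem isInducing_jets [Finite ι] (hr : 1 ≤ r) (hKc : ∀ i, IsCompact (K i))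
    (hK : ∀ i, K i ⊆ f.dom (c i)) (hch : ∀ i, K i ⊆ T.changeDom (c i) (c i))
    (hcov : ∀ w, ∃ i, ∃ y ∈ interior (K i), (O.chart (c i)).proj y = w) :
    IsInducing (jets (T := T) hK) := by
  refine isInducing_iff_nhds.2 fun σ => le_antisymm ?_ ?_
  · exact tendsto_iff_comap.1 (Continuous.tendsto (continuous_pi fun i => continuous_pi fun j =>
      continuous_derivOn hr (hKc i) (hch i) j) σ)
  · rw [nhds_induced, ← tendsto_iff_comap, TopologicalSpace.tendsto_nhds_generateFrom_iff]
    rintro _ ⟨g₀, x, z, A, s, ε, hA, hAg₀, hg₀, hs, -, rfl⟩ hσ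
    refine eventually_mem_mapNhd hr hA hAg₀ hg₀ hs hσ fun M hM => ?_
    obtain ⟨hAch, -⟩ := (σ.toOrbMap_mem_mapNhd_iff hr g₀ x z A s ε).1 hσ
    obtain ⟨C, hC⟩ := exists_jetClose_repr_of_cover (T := T) hK hcov hA
      (hAch.trans changeDom_subset_dom) hs
    obtain ⟨δ, hδ, hCδ⟩ := exists_pos_mul_lt hM C
    filter_upwards [eventually_jetClose_of_tendsto_jets hKc hK tendsto_comap hs hδ] with τ hτ y hy
    exact (hC y hy τ σ δ hτ).mono hCδ.le

end Cover

end Orbisection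

end CompleteOrbifoldMap.Transitions

/-! ### Closed range and finite covers -/

theorem continuousMap_ext_of_eqOn_interior {E F : Type*} [TopologicalSpace E] [TopologicalSpace F]
    [T2Space F] {K : Set E} (hK : closure (interior K) = K) {g h : C(K, F)}
    (H : ∀ y : K, (y : E) ∈ interior K → g y = h y) : g = h := by
  have hdense : Dense ((↑) ⁻¹' interior K : Set K) := by
    rw [Subtype.dense_iff, Subtype.image_preimage_coe, inter_eq_right.2 interior_subset, hK]
  exact DFunLike.coe_injective (g.continuous.ext_on hdense h.continuous H)

theorem isClosedEmbedding_of_comp {E F G : Type*} [TopologicalSpace E] [TopologicalSpace F]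
    [TopologicalSpace G] {g : F → G} {f : E → F} (hg : IsEmbedding g)
    (h : IsClosedEmbedding (g ∘ f)) : IsClosedEmbedding f := by
  refine ⟨hg.of_comp_iff.1 h.isEmbedding, ?_⟩
  rw [← preimage_image_eq (range f) hg.injective, ← range_comp]
  exact h.isClosed_range.preimage hg.continuous

section ContinuousFunctions

variable {V : Type*} [AddCommGroup V] [Module ℝ V] [TopologicalSpace V] {ι κ : Type*}
  {S : ι → Type*} [∀ i, TopologicalSpace (S i)] [∀ i, CompactSpace (S i)]
  {F : κ → Type*} [∀ j, NormedAddCommGroup (F j)] [∀ j, NormedSpace ℝ (F j)]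
  [∀ j, CompleteSpace (F j)] {L : V →ₗ[ℝ] ∀ i j, C(S i, F j)}

theorem isFrechet_of_isClosedEmbedding_pi_continuousMap [Countable ι] [Countable κ]
    [IsTopologicalAddGroup V] (hL : IsClosedEmbedding L) : IsFrechet V :=
  isFrechet_of_isClosedEmbedding hL

theorem isBanachable_of_isClosedEmbedding_pi_continuousMap [Finite ι] [Finite κ]
    (hL : IsClosedEmbedding L) : IsBanachable V := by
  have := Fintype.ofFinite ι
  have := Fintype.ofFinite κ
  exact isBanachable_of_isClosedEmbedding hL

end ContinuousFunctions

theorem finite_natCast_le {r : ℕ∞} (hr : r ≠ ⊤) : Finite {j : ℕ // (j : ℕ∞) ≤ r} := by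
  obtain ⟨s, rfl⟩ := ENat.ne_top_iff_exists.1 hr
  exact (finite_Iic s).subset fun j (hj : (j : ℕ∞) ≤ s) =>
    mem_Iic.2 (by exact_mod_cast hj)

namespace CompleteOrbifoldMap.Transitions

variable {n m : ℕ} {r : ℕ∞} {X Y : Type*} [TopologicalSpace X] [TopologicalSpace Y]
  {O : Orbifold n (r + 1) X} {P : Orbifold m (r + 1) Y} {f : CompleteOrbifoldMap O P}
  {T : f.Transitions} {x : X}

namespace Orbisection

section Limits

variable {l : Filter (T.Orbisection r)} {s : X → Eu n → Eu m}

theorem isCompatible_of_tendsto [l.NeBot]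
    (hs : ∀ x y, Tendsto (fun σ : T.Orbisection r => σ.repr x y) l (𝓝 (s x y)))
    (hsm : ∀ x, ContDiffOn ℝ (r : WithTop ℕ∞) (s x) (f.dom x)) : T.IsCompatible r s where
  eq_zero x y hy := by
    refine tendsto_nhds_unique (hs x y) ?_
    simp only [fun σ : T.Orbisection r => σ.repr_eq_zero x y hy, tendsto_const_nhds]
  contDiffOn := hsm
  act x γ y hy := by
    refine tendsto_nhds_unique (hs x _) ?_
    simp only [fun σ : T.Orbisection r => σ.repr_act γ hy]
    exact ((ContinuousLinearMap.continuous _).tendsto _).comp (hs x y)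
  ψ_center w x hw := by
    refine tendsto_nhds_unique (hs x _) ?_
    simp only [fun σ : T.Orbisection r => σ.repr_ψ_center le_add_self hw]
    exact ((ContinuousLinearMap.continuous _).tendsto _).comp (hs w _)

variable {ι : Type*} {c : ι → X} {K : ι → Set (Eu n)} {g : ι → Eu n → Eu m}

theorem exists_contDiffAt_forall_tendsto_repr (hK : ∀ i, K i ⊆ f.dom (c i))
    (hcov : ∀ w, ∃ i, ∃ y ∈ interior (K i), (O.chart (c i)).proj y = w)
    (hg : ∀ i, ContDiffOn ℝ (r : WithTop ℕ∞) (g i) (interior (K i)))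
    (hl : ∀ i, ∀ y ∈ interior (K i),
      Tendsto (fun σ : T.Orbisection r => σ.repr (c i) y) l (𝓝 (g i y)))
    {y : Eu n} (hy : y ∈ f.dom x) :
    ∃ h : Eu n → Eu m, ContDiffAt ℝ (r : WithTop ℕ∞) h y ∧
      ∀ᶠ u in 𝓝 y, Tendsto (fun σ : T.Orbisection r => σ.repr x u) l (𝓝 (h u)) := by
  obtain ⟨i, y', hy', hproj⟩ := hcov ((O.chart x).proj y)
  obtain ⟨φ, Q, hφ, hQ, rfl, he⟩ := T.transfer_of_proj_eq hy (hK i (interior_subset hy'))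
    hproj.symm
  have hKi := isOpen_interior.mem_nhds hy'
  refine ⟨fun u => Q u (g i (φ u)), hQ.clm_apply (((hg i).contDiffAt hKi).comp y hφ), ?_⟩
  filter_upwards [he, hφ.continuousAt hKi] with u hu huK
  simp only [hu]
  exact ((Q u).continuous.tendsto _).comp (hl i _ huK)

theorem exists_eqOn_interior_of_tendsto [l.NeBot] (hK : ∀ i, K i ⊆ f.dom (c i))
    (hcov : ∀ w, ∃ i, ∃ y ∈ interior (K i), (O.chart (c i)).proj y = w)
    (hg : ∀ i, ContDiffOn ℝ (r : WithTop ℕ∞) (g i) (interior (K i)))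
    (hl : ∀ i, ∀ y ∈ interior (K i),
      Tendsto (fun σ : T.Orbisection r => σ.repr (c i) y) l (𝓝 (g i y))) :
    ∃ σ : T.Orbisection r, ∀ i, EqOn (σ.repr (c i)) (g i) (interior (K i)) := by
  have hloc {x : X} {y : Eu n} (hy : y ∈ f.dom x) :=
    exists_contDiffAt_forall_tendsto_repr hK hcov hg hl hy
  have hlim : ∀ x y, ∃ v, Tendsto (fun σ : T.Orbisection r => σ.repr x y) l (𝓝 v) := by
    intro x y
    by_cases hy : y ∈ f.dom x
    · obtain ⟨h, -, hh⟩ := hloc hy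
      exact ⟨h y, hh.self_of_nhds⟩
    · simp only [fun σ : T.Orbisection r => σ.repr_eq_zero x y hy]
      exact ⟨0, tendsto_const_nhds⟩
  choose s hs using hlim
  have hsm : ∀ x, ContDiffOn ℝ (r : WithTop ℕ∞) (s x) (f.dom x) := by
    intro x y hy
    obtain ⟨h, hh, hlh⟩ := hloc hy
    refine (hh.congr_of_eventuallyEq ?_).contDiffWithinAt
    filter_upwards [hlh] with u hu using tendsto_nhds_unique (hs x u) hu
  exact ⟨(isCompatible_of_tendsto hs hsm).toOrbisection,
    fun i y hy => tendsto_nhds_unique (hs (c i) y) (hl i y hy)⟩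

end Limits

section Cover

variable {ι : Type*} {c : ι → X} {K : ι → Set (Eu n)}

theorem jets_mem_crSpace (hK : ∀ i, K i ⊆ f.dom (c i)) (σ : T.Orbisection r) (i : ι) :
    jets hK σ i ∈ CrSpace r (K i) (Eu m) :=
  ⟨σ.repr (c i), (σ.contDiffOn_repr (c i)).mono (interior_subset.trans (hK i)),
    fun _ _ _ => rfl⟩

theorem tendsto_repr_of_tendsto_jets (hK : ∀ i, K i ⊆ f.dom (c i))
    {l : Filter (T.Orbisection r)}
    {J : ∀ (i : ι) (j : {j : ℕ // (j : ℕ∞) ≤ r}), C(K i, Eu n [×(j : ℕ)]→L[ℝ] Eu m)}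
    (hl : Tendsto (jets hK) l (𝓝 J)) {i : ι} {y : Eu n} (hy : y ∈ K i) :
    Tendsto (fun σ : T.Orbisection r => σ.repr (c i) y) l
      (𝓝 (J i ⟨0, zero_le⟩ ⟨y, hy⟩ 0)) := by
  have hjet := tendsto_pi_nhds.1 (tendsto_pi_nhds.1 hl i) ⟨0, zero_le⟩
  have heval := ((continuous_eval_const (⟨y, hy⟩ : K i)).tendsto _).comp hjet
  exact ((ContinuousMultilinearMap.apply ℝ (fun _ : Fin 0 => Eu n) (Eu m)
    0).continuous.tendsto _).comp heval

theorem isClosed_range_jets (hKc : ∀ i, IsCompact (K i))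
    (hKi : ∀ i, closure (interior (K i)) = K i) (hK : ∀ i, K i ⊆ f.dom (c i))
    (hcov : ∀ w, ∃ i, ∃ y ∈ interior (K i), (O.chart (c i)).proj y = w) :
    IsClosed (range (jets (T := T) hK)) := by
  refine isClosed_of_closure_subset fun J hJ => ?_
  let l : Filter (T.Orbisection r) := comap (jets hK) (𝓝 J)
  have hl : Tendsto (jets hK) l (𝓝 J) := tendsto_comap
  have : l.NeBot := comap_neBot fun U hU =>
    let ⟨_, hσU, σ, hσ⟩ := mem_closure_iff_nhds.1 hJ U hU
    ⟨σ, hσ ▸ hσU⟩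
  have hJmem : ∀ i, J i ∈ CrSpace r (K i) (Eu m) := fun i =>
    (isClosed_crSpace r (hKc i) (Eu m)).mem_of_tendsto (tendsto_pi_nhds.1 hl i)
      (Eventually.of_forall fun σ => jets_mem_crSpace hK σ i)
  choose g hg hgJ using hJmem
  obtain ⟨σ, hσ⟩ := exists_eqOn_interior_of_tendsto hK hcov hg fun i y hy => by
    have h := tendsto_repr_of_tendsto_jets hK hl (interior_subset hy)
    rwa [hgJ i _ _ hy] at h
  refine ⟨σ, funext fun i => funext fun j =>
    continuousMap_ext_of_eqOn_interior (hKi i) fun y hy => ?_⟩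
  have heq : σ.repr (c i) =ᶠ[𝓝 (y : Eu n)] g i :=
    (hσ i).eventuallyEq_of_mem (isOpen_interior.mem_nhds hy)
  exact ((heq.iteratedFDeriv ℝ j).eq_of_nhds).trans (hgJ i j y hy).symm

theorem exists_isClosedEmbedding_crSpace (hK : ∀ i, K i ⊆ f.dom (c i))
    (hJ : IsClosedEmbedding (jets (T := T) hK)) :
    ∃ L : T.Orbisection r →L[ℝ] (∀ i, CrSpace r (K i) (Eu m)), IsClosedEmbedding L ∧
      ∀ (σ : T.Orbisection r) (i : ι) (j : {j : ℕ // (j : ℕ∞) ≤ r}) (y : K i),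
        (L σ i).1 j y = iteratedFDeriv ℝ (j : ℕ) (σ.repr (c i)) y := by
  let L : T.Orbisection r →ₗ[ℝ] (∀ i, CrSpace r (K i) (Eu m)) := LinearMap.pi fun i =>
    (LinearMap.pi fun j => derivOn (hK i) j).codRestrict _ fun σ => jets_mem_crSpace hK σ i
  have hL : IsClosedEmbedding L := isClosedEmbedding_of_comp
    (IsEmbedding.piMap fun i => IsEmbedding.subtypeVal (p := (· ∈ CrSpace r (K i) (Eu m)))) hJ
  exact ⟨⟨L, hL.continuous⟩, hL, fun _ _ _ _ => rfl⟩

theorem separableSpace_of_isInducing_jets [Finite ι] (hKc : ∀ i, IsCompact (K i))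
    (hK : ∀ i, K i ⊆ f.dom (c i)) (hJ : IsInducing (jets (T := T) hK)) :
    TopologicalSpace.SeparableSpace (T.Orbisection r) := by
  have : ∀ i, CompactSpace (K i) := fun i => isCompact_iff_compactSpace.1 (hKc i)
  have (j : ℕ) := secondCountableTopology_continuousMultilinearMap (E := Eu n) (F := Eu m) j
  have := hJ.secondCountableTopology
  infer_instance

theorem isFrechet_of_isClosedEmbedding_jets [Finite ι] [IsTopologicalAddGroup (T.Orbisection r)]
    (hKc : ∀ i, IsCompact (K i)) (hK : ∀ i, K i ⊆ f.dom (c i))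
    (hJ : IsClosedEmbedding (jets (T := T) hK)) : IsFrechet (T.Orbisection r) := by
  have : ∀ i, CompactSpace (K i) := fun i => isCompact_iff_compactSpace.1 (hKc i)
  exact isFrechet_of_isClosedEmbedding_pi_continuousMap (L := jets hK) hJ

theorem isBanachable_of_isClosedEmbedding_jets [Finite ι] (hr : r ≠ ⊤)
    (hKc : ∀ i, IsCompact (K i)) (hK : ∀ i, K i ⊆ f.dom (c i))
    (hJ : IsClosedEmbedding (jets (T := T) hK)) : IsBanachable (T.Orbisection r) := by
  have : ∀ i, CompactSpace (K i) := fun i => isCompact_iff_compactSpace.1 (hKc i)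
  have := finite_natCast_le hr
  exact isBanachable_of_isClosedEmbedding_pi_continuousMap (L := jets hK) hJ

end Cover

end Orbisection

end CompleteOrbifoldMap.Transitions

namespace OrbifoldChart

variable {n : ℕ} {k : ℕ∞} {X : Type*} [TopologicalSpace X] {x : X} (c : OrbifoldChart n k X x)

theorem isOpen_image_act (γ : c.Γ) {U : Set (Eu n)} (hU : IsOpen U) (hUd : U ⊆ c.dom) :
    IsOpen (c.act γ '' U) := by
  have himage : c.act γ '' U = c.dom ∩ c.act γ⁻¹ ⁻¹' U := by
    ext u
    constructor
    · rintro ⟨v, hv, rfl⟩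
      exact ⟨c.mapsTo_act γ (hUd hv), by rwa [mem_preimage, c.act_inv_act γ (hUd hv)]⟩
    · rintro ⟨hu, hu'⟩
      exact ⟨_, hu', c.act_act_inv γ hu⟩
  rw [himage]
  exact (c.contDiffOn_act γ⁻¹).continuousOn.isOpen_inter_preimage c.isOpen_dom hU

theorem closure_interior_iUnion_image_act {U : Set (Eu n)} (hU : IsOpen U)
    (hUd : closure U ⊆ c.dom) (hc : IsClosed (⋃ γ, c.act γ '' closure U)) :
    closure (interior (⋃ γ, c.act γ '' closure U)) = ⋃ γ, c.act γ '' closure U := by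
  refine (closure_minimal interior_subset hc).antisymm (iUnion_subset fun γ => ?_)
  refine ((c.contDiffOn_act γ).continuousOn.mono hUd).image_closure.trans (closure_mono ?_)
  exact interior_maximal (subset_iUnion_of_subset γ (image_mono subset_closure))
    (c.isOpen_image_act γ hU (subset_closure.trans hUd))

theorem exists_isCompact_invariant_subset {V : Set (Eu n)} (hV : V ∈ 𝓝 c.center) :
    ∃ K ⊆ V, IsCompact K ∧ closure (interior K) = K ∧ (∀ γ, MapsTo (c.act γ) K K) ∧
      c.center ∈ interior K := by
  have hev : ∀ᶠ u in 𝓝 c.center, u ∈ c.dom ∧ ∀ γ, c.act γ u ∈ V := by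
    refine Eventually.and (c.isOpen_dom.mem_nhds c.center_mem) (eventually_all.2 fun γ => ?_)
    exact c.continuousAt_act γ c.center_mem ((c.act_center γ).symm ▸ hV)
  obtain ⟨ρ, hρ, hball⟩ := Metric.nhds_basis_closedBall.mem_iff.1 hev
  have hcl : closure (Metric.ball c.center ρ) = Metric.closedBall c.center ρ :=
    closure_ball _ hρ.ne'
  have hd : closure (Metric.ball c.center ρ) ⊆ c.dom := fun u hu => (hball (hcl ▸ hu)).1
  have hcompact : IsCompact (⋃ γ, c.act γ '' closure (Metric.ball c.center ρ)) :=
    isCompact_iUnion fun γ => (hcl ▸ isCompact_closedBall _ _ : IsCompact (closure _))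
      |>.image_of_continuousOn ((c.contDiffOn_act γ).continuousOn.mono hd)
  refine ⟨_, iUnion_subset fun γ => ?_, hcompact,
    c.closure_interior_iUnion_image_act Metric.isOpen_ball hd hcompact.isClosed,
    fun δ u hu => ?_, mem_interior_iff_mem_nhds.2 ?_⟩
  · rintro _ ⟨u, hu, rfl⟩
    exact (hball (hcl ▸ hu)).2 γ
  · obtain ⟨γ, v, hv, rfl⟩ := mem_iUnion.1 hu
    exact mem_iUnion.2 ⟨δ * γ, v, hv, c.act_mul δ γ v (hd hv)⟩
  · filter_upwards [Metric.ball_mem_nhds c.center hρ] with u hu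
    exact mem_iUnion.2 ⟨1, u, subset_closure hu, c.act_one u (hd (subset_closure hu))⟩

end OrbifoldChart

namespace CompleteOrbifoldMap.Transitions

variable {n m : ℕ} {r : ℕ∞} {X Y : Type*} [TopologicalSpace X] [TopologicalSpace Y]
  {O : Orbifold n (r + 1) X} {P : Orbifold m (r + 1) Y} {f : CompleteOrbifoldMap O P}

theorem exists_finite_cover [CompactSpace X] (T : f.Transitions) :
    ∃ (N : ℕ) (c : Fin N → X) (K : Fin N → Set (Eu n)),
      (∀ i, K i ⊆ T.changeDom (c i) (c i)) ∧ (∀ i, IsCompact (K i)) ∧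
      (∀ i, closure (interior (K i)) = K i) ∧
      (∀ i γ, MapsTo ((O.chart (c i)).act γ) (K i) (K i)) ∧
      ∀ w, ∃ i, ∃ y ∈ interior (K i), (O.chart (c i)).proj y = w := by
  choose K hch hKc hKi hinv hcenter using fun x =>
    (O.chart x).exists_isCompact_invariant_subset (T.changeDom_self_mem_nhds x)
  have hnhds (x : X) : (O.chart x).proj '' interior (K x) ∈ 𝓝 x := by
    have hd := (hch x).trans (changeDom_subset_dom.trans (f.dom_subset x))
    have hopen := (O.chart x).isOpen_image_proj _ (interior_subset.trans hd) isOpen_interior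
    exact hopen.mem_nhds ⟨_, hcenter x, (O.chart x).proj_center⟩
  obtain ⟨t, ht⟩ := CompactSpace.elim_nhds_subcover _ hnhds
  refine ⟨t.card, fun i => t.equivFin.symm i, fun i => K (t.equivFin.symm i),
    fun i => hch _, fun i => hKc _, fun i => hKi _, fun i => hinv _, fun w => ?_⟩
  obtain ⟨x, hx, hw⟩ := mem_iUnion₂.1 (ht.ge (mem_univ w))
  obtain ⟨i, rfl⟩ : ∃ i, (t.equivFin.symm i : X) = x :=
    (t.equivFin.symm.surjective ⟨x, hx⟩).imp fun _ => congrArg Subtype.val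
  exact ⟨i, hw⟩

end CompleteOrbifoldMap.Transitions

theorem proposition5p6_general {n m : ℕ} {X Y : Type*} [TopologicalSpace X] [CompactSpace X]
    [TopologicalSpace Y] (r : ℕ∞) (hr : 1 ≤ r) (O : Orbifold n (r + 1) X)
    (P : Orbifold m (r + 1) Y) (f : CompleteOrbifoldMap O P) (T : f.Transitions) :
    ∃ (_ : AddCommGroup (T.Orbisection r)) (_ : Module ℝ (T.Orbisection r))
      (_ : IsTopologicalAddGroup (T.Orbisection r)) (_ : ContinuousSMul ℝ (T.Orbisection r)),
      (∀ (σ τ : T.Orbisection r) (x : X) (y : Eu n),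
        (σ + τ).repr x y = σ.repr x y + τ.repr x y) ∧
      (∀ (a : ℝ) (σ : T.Orbisection r) (x : X) (y : Eu n),
        (a • σ).repr x y = a • σ.repr x y) ∧
      TopologicalSpace.SeparableSpace (T.Orbisection r) ∧
      (r ≠ ⊤ → IsBanachable (T.Orbisection r)) ∧
      IsFrechet (T.Orbisection r) ∧
      ∃ (N : ℕ) (c : Fin N → X) (K : Fin N → Set (Eu n)),
        (∀ i, IsCompact (K i) ∧ closure (interior (K i)) = K i ∧ K i ⊆ f.dom (c i) ∧
          ∀ γ, Set.MapsTo ((O.chart (c i)).act γ) (K i) (K i)) ∧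
        (⋃ i, (O.chart (c i)).proj '' K i) = Set.univ ∧
        ∃ L : T.Orbisection r →L[ℝ] (∀ i, CrSpace r (K i) (Eu m)),
          Topology.IsClosedEmbedding L ∧
          ∀ (σ : T.Orbisection r) (i : Fin N) (j : {j : ℕ // (j : ℕ∞) ≤ r}) (y : K i),
            (L σ i).1 j y = iteratedFDeriv ℝ (j : ℕ) (σ.repr (c i)) y := by
  open CompleteOrbifoldMap.Transitions Orbisection in
  obtain ⟨N, c, K, hch, hKc, hKi, hinv, hcov⟩ := T.exists_finite_cover
  have hK (i : Fin N) : K i ⊆ f.dom (c i) := (hch i).trans changeDom_subset_dom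
  have hind := isInducing_jets hr hKc hK hch hcov
  have hJ : IsClosedEmbedding (jets (T := T) hK) :=
    ⟨⟨hind, jets_injective hK hcov⟩, isClosed_range_jets hKc hKi hK hcov⟩
  have hgroup : IsTopologicalAddGroup (T.Orbisection r) := hind.topologicalAddGroup (jets hK)
  have hsmul : ContinuousSMul ℝ (T.Orbisection r) :=
    hind.continuousSMul continuous_id (map_smul (jets hK) _ _)
  have hunion : (⋃ i, (O.chart (c i)).proj '' K i) = univ := by
    refine eq_univ_of_forall fun w => mem_iUnion.2 ?_
    obtain ⟨i, y, hy, hyw⟩ := hcov w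
    exact ⟨i, y, interior_subset hy, hyw⟩
  exact ⟨inferInstance, inferInstance, hgroup, hsmul,
    fun σ τ => congrFun₂ (repr_add σ τ), fun a σ => congrFun₂ (repr_smul a σ),
    separableSpace_of_isInducing_jets hKc hK hind,
    fun hr_top => isBanachable_of_isClosedEmbedding_jets hr_top hKc hK hJ,
    isFrechet_of_isClosedEmbedding_jets hKc hK hJ, N, c, K,
    fun i => ⟨hKc i, hKi i, hK i, hinv i⟩, hunion, exists_isClosedEmbedding_crSpace hK hJ⟩

theorem proposition5p6 {n m : ℕ} {X Y : Type*}
    [TopologicalSpace X] [T2Space X] [CompactSpace X]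
    [TopologicalSpace Y] [T2Space Y] [ParacompactSpace Y]
    (r : ℕ∞) (hr : 1 ≤ r) (O : Orbifold n (r + 1) X) (P : Orbifold m (r + 1) Y)
    (f : CompleteOrbifoldMap O P) (T : f.Transitions) :
    ∃ (_ : AddCommGroup (T.Orbisection r)) (_ : Module ℝ (T.Orbisection r))
      (_ : IsTopologicalAddGroup (T.Orbisection r)) (_ : ContinuousSMul ℝ (T.Orbisection r)),
      (∀ (σ τ : T.Orbisection r) (x : X) (y : Eu n),
        (σ + τ).repr x y = σ.repr x y + τ.repr x y) ∧
      (∀ (a : ℝ) (σ : T.Orbisection r) (x : X) (y : Eu n),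
        (a • σ).repr x y = a • σ.repr x y) ∧
      TopologicalSpace.SeparableSpace (T.Orbisection r) ∧
      (r ≠ ⊤ → IsBanachable (T.Orbisection r)) ∧
      (r = ⊤ → IsFrechet (T.Orbisection r)) ∧
      ∃ (N : ℕ) (c : Fin N → X) (K : Fin N → Set (Eu n)),
        (∀ i, IsCompact (K i) ∧ closure (interior (K i)) = K i ∧ K i ⊆ f.dom (c i) ∧
          ∀ γ, Set.MapsTo ((O.chart (c i)).act γ) (K i) (K i)) ∧
        (⋃ i, (O.chart (c i)).proj '' K i) = Set.univ ∧
        ∃ L : T.Orbisection r →L[ℝ] (∀ i, CrSpace r (K i) (Eu m)),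
          Topology.IsClosedEmbedding L ∧
          ∀ (σ : T.Orbisection r) (i : Fin N) (j : {j : ℕ // (j : ℕ∞) ≤ r}) (y : K i),
            (L σ i).1 j y = iteratedFDeriv ℝ (j : ℕ) (σ.repr (c i)) y := by
  obtain ⟨G, M, hG, hM, hadd, hsmul, hsep, hbanach, hfrechet, h⟩ :=
    proposition5p6_general r hr O P f T
  exact ⟨G, M, hG, hM, hadd, hsmul, hsep, hbanach, fun _ => hfrechet, h⟩
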